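/- For a field $L$ let $\mathrm{Val}_L$ be its Riemann–Zariski space: the set of all valuation rings of $L$ with fraction field $L$ (including $L$ itself), with the Zariski topology, a basis of which is given by the sets $\{\mathcal O : x_1,\dots,x_n\in\mathcal O\}$ for $x_1,\dots,x_n\in L$. For a valued field $k$ (with a valuation of arbitrary rank) let $k^\circ$ be its ring of integers and $k^h$ its henselization, i.e. the valued field whose ring of integers is the henselization of $k^\circ$. Let $k$ be a henselian valued field, let $p$ be the characteristic exponent of its residue field, and let $k^u$ be the extension of $k$ whose ring of integers is the strict henselization of $k^\circ$. An algebraic extension $l/k$ is called unramified if $l\subseteq k^u$, and totally ramified if $l$ is linearly disjoint from $k^u$ over $k$. It is called tame if it splits into a tower $l/m/k$ such that $m/k$ is unramified, $l/m$ is totally ramified, and the degree of every finite subextension of $l/m$ is prime to $p$. An algebraic extension $l/k$ of arbitrary valued fields is called tame (resp. unramified) if $l^h/k^h$ is tame (resp. unramified). For an algebraic field extension $L/K$, the tame locus (resp. the unramified locus) of $L/K$ is the set of all $\mathcal O\in\mathrm{Val}_L$ such that $L/K$ is tame (resp. unramified) with respect to the valuations of $L$ and $K$ with rings of integers $\mathcal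 O$ and $\mathcal O\cap K$. Theorem. For every finite field extension $L/K$, both the tame locus and the unramified locus of $L/K$ are open subsets of $\mathrm{Val}_L$. -/

import Mathlib

universe u v

/-! ### The Riemann–Zariski space of a field -/

/-- The Zariski topology on the Riemann–Zariski space `Val_L`, the set of all valuation rings of
the field `L` (the trivial one included). The sets `{𝒪 | x₁, …, xₙ ∈ 𝒪}` form a basis. -/
instance ValuationSubring.zariskiTopology (L : Type u) [Field L] :
    TopologicalSpace (ValuationSubring L) :=
  TopologicalSpace.generateFrom (Set.range fun x : L => {O : ValuationSubring L | x ∈ O})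

/-! ### `𝒫`-extensions -/

/-- An algebraic extension `l/k` is a `P`-extension if every prime divisor of the degree of every
finite subextension lies in `P`. -/
def IsPExtension (P : Set ℕ) (k : Type u) (l : Type v) [Field k] [Field l] [Algebra k l] : Prop :=
  Algebra.IsAlgebraic k l ∧
    ∀ E : IntermediateField k l, FiniteDimensional k E →
      ∀ q : ℕ, q.Prime → q ∣ Module.finrank k E → q ∈ P

/-! ### Ramification theory inside an algebraic closure

Throughout, `Ω` is an algebraic closure of the valued fields under consideration, which are viewed
as subfields of `Ω`, and `A` is a valuation ring of `Ω`. Each subfield `k` of `Ω` is provided with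
the induced valuation, whose ring of integers is `A ∩ k`. -/

namespace ValuedSubfield

variable {Ω : Type u} [Field Ω] (A : ValuationSubring Ω)

/-- The ring of integers `k° = A ∩ k` of the valued field `k`, a valuation ring of `k`. -/
abbrev integers (k : Subfield Ω) : ValuationSubring k := A.comap k.subtype

/-- The valued field `k` is henselian: the local ring `k°` is henselian. -/
def IsHenselian (k : Subfield Ω) : Prop := HenselianLocalRing (integers A k)

/-- The local ring `k°` is strictly henselian: it is henselian and its residue field is separably
closed. -/
def IsStrictlyHenselian (k : Subfield Ω) : Prop :=
  IsHenselian A k ∧ IsSepClosed (IsLocalRing.ResidueField (integers A k))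

/-- The henselization `k^h` of the valued field `k`: the least henselian valued field between
`k` and its algebraic closure `Ω`. Its ring of integers is the henselization of `k°`. -/
def henselization (k : Subfield Ω) : Subfield Ω := sInf {E | k ≤ E ∧ IsHenselian A E}

/-- The field `k^u`: the least strictly henselian valued field between `k` and its algebraic
closure `Ω`. Its ring of integers is the strict henselization of `k°`. -/
def maxUnramified (k : Subfield Ω) : Subfield Ω := sInf {E | k ≤ E ∧ IsStrictlyHenselian A E}

theorem le_henselization (k : Subfield Ω) : k ≤ henselization A k :=
  le_sInf fun _ h => h.1

theorem le_maxUnramified (k : Subfield Ω) : k ≤ maxUnramified A k :=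
  le_sInf fun _ h => h.1

/-- An algebraic extension `l/k` of valued fields, with `k` henselian, is unramified if it is
contained in the maximal unramified extension `k^u` of `k`. -/
def IsUnramifiedHens (k l : Subfield Ω) : Prop := k ≤ l ∧ l ≤ maxUnramified A k

/-- An algebraic extension `l/k` of valued fields, with `k` henselian, is totally ramified if `l`
is linearly disjoint from `k^u` over `k`. -/
def IsTotallyRamifiedHens {k l : Subfield Ω} (h : k ≤ l) : Prop :=
  (Subfield.extendScalars h).LinearDisjoint (Subfield.extendScalars (le_maxUnramified A k))

/-- The residual characteristic exponent of the valued field `k`. -/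
noncomputable def residueExpChar (k : Subfield Ω) : ℕ :=
  ringExpChar (IsLocalRing.ResidueField (integers A k))

/-- An algebraic extension `l/k` of valued fields, with `k` henselian of residual characteristic
exponent `p`, is tame if it splits into a tower `l/m/k` such that `m/k` is unramified and `l/m` is
a totally ramified `p'`-extension. -/
def IsTameHens (k l : Subfield Ω) : Prop :=
  ∃ (m : Subfield Ω) (h : m ≤ l), IsUnramifiedHens A k m ∧ IsTotallyRamifiedHens A h ∧
    IsPExtension {q | q.Prime ∧ ¬ q ∣ residueExpChar A k} m (Subfield.extendScalars h)

/-- An algebraic extension `l/k` of valued fields is unramified if `l^h/k^h` is so. -/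
def IsUnramified (k l : Subfield Ω) : Prop :=
  IsUnramifiedHens A (henselization A k) (henselization A l)

/-- An algebraic extension `l/k` of valued fields is tame if `l^h/k^h` is so. -/
def IsTame (k l : Subfield Ω) : Prop :=
  IsTameHens A (henselization A k) (henselization A l)

end ValuedSubfield

/-! ### The tame and the unramified locus

For an algebraic extension `L/K` and a valuation ring `O` of `L`, the algebraic closure of `L` is
provided with a valuation ring `A` that induces `O` on `L`, hence `O ∩ K` on `K`. Such an `A`
exists and is unique up to an automorphism over `L`, so its choice does not matter. -/

/-- `L/K` is tame with respect to the valuations of `L` and `K` given by `O` and `O ∩ K`. -/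
def IsTameAt (K : Type v) {L : Type u} [Field K] [Field L] [Algebra K L]
    (O : ValuationSubring L) : Prop :=
  ∃ A : ValuationSubring (AlgebraicClosure L),
    A.comap (algebraMap L (AlgebraicClosure L)) = O ∧
      ValuedSubfield.IsTame A (algebraMap K (AlgebraicClosure L)).fieldRange
        (algebraMap L (AlgebraicClosure L)).fieldRange

/-- `L/K` is unramified with respect to the valuations of `L` and `K` given by `O` and `O ∩ K`. -/
def IsUnramifiedAt (K : Type v) {L : Type u} [Field K] [Field L] [Algebra K L]
    (O : ValuationSubring L) : Prop :=
  ∃ A : ValuationSubring (AlgebraicClosure L),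
    A.comap (algebraMap L (AlgebraicClosure L)) = O ∧
      ValuedSubfield.IsUnramified A (algebraMap K (AlgebraicClosure L)).fieldRange
        (algebraMap L (AlgebraicClosure L)).fieldRange

/-- The tame locus of an algebraic extension `L/K`, a subset of `Val_L`. -/
def tameLocus (K : Type v) (L : Type u) [Field K] [Field L] [Algebra K L] :
    Set (ValuationSubring L) :=
  {O | IsTameAt K O}

/-- The unramified locus of an algebraic extension `L/K`, a subset of `Val_L`. -/
def unramifiedLocus (K : Type v) (L : Type u) [Field K] [Field L] [Algebra K L] :
    Set (ValuationSubring L) :=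
  {O | IsUnramifiedAt K O}

open Polynomial

/-! ### Simple roots modulo the maximal ideal -/

namespace ValuedSubfield

section SimpleRoots

variable {Ω : Type u} [Field Ω] (A : ValuationSubring Ω)

/-! Let Ω be the algebraic closure of L, let k ≤ l be the images of K and L in it, and let A be a
valuation ring of Ω. Both conditions become statements about automorphisms σ of Ω over k. Unramified
means l ≤ k^u (`isUnramified_iff`); tame means that every prime dividing [k^u l : k^u] is a unit of
A (`isTame_iff`). Automorphisms over k^u preserve A and act trivially on its residue field
(`IsStrictlyHenselian.valuation_map_sub_lt`); conversely, a σ with σa ≡ a for all separable a in A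
fixes k^u (`maxUnramified_isSeparable_and_fixed`). So, for l/k separable, unramified means that
inertia fixes l. Over k^u, degree prime to the residue characteristic means being fixed by the σ
with v(σx − x) < v(x) (`IsStrictlyHenselian.tame_degree_iff`), so tame means that wild inertia fixes
l.

Each of these conditions on σ concerns one separable x and says that σx − x, respectively (σx −
x)/x, is a non-unit. By compactness of the Galois group finitely many x already force σ to fix l
(`exists_finset_forall_algEquiv`). As σx runs over the finitely many conjugates of x, there is a
finite subset Z of A such that, once A' contains Z, the conditions for A' imply those for A
(`exists_finset_valuation_lt_one`). Hence the (wild) inertia of A' still fixes l, and the property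
holds near A in the Riemann–Zariski space of Ω. It descends to L because restriction of valuation
rings from Ω to L is open (`ValuationSubring.exists_finset_extend`). -/

theorem exists_map_eq_of_coeff_mem {f : Polynomial Ω} (hf : ∀ i, f.coeff i ∈ A) :
    ∃ g : A[X], g.map A.subtype = f :=
  ⟨f.toSubring A.toSubring (fun c hc => by
    obtain ⟨i, -, rfl⟩ := Polynomial.mem_coeffs_iff.1 hc
    exact hf i), Polynomial.map_toSubring f A.toSubring _⟩

theorem eval_mem {f : Polynomial Ω} (hf : ∀ i, f.coeff i ∈ A) {a : Ω} (ha : a ∈ A) :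
    f.eval a ∈ A := by
  obtain ⟨g, rfl⟩ := exists_map_eq_of_coeff_mem A hf
  have : (g.map A.subtype).eval a = A.subtype (g.eval ⟨a, ha⟩) :=
    Polynomial.eval_map_apply (f := A.subtype) (x := (⟨a, ha⟩ : A))
  rw [this]
  exact SetLike.coe_mem _

theorem derivative_coeff_mem {f : Polynomial Ω} (hf : ∀ i, f.coeff i ∈ A) (i : ℕ) :
    f.derivative.coeff i ∈ A := by
  rw [Polynomial.coeff_derivative]
  exact A.mul_mem _ _ (hf _) (by exact_mod_cast natCast_mem A (i + 1))

theorem mem_of_sub_lt {a b : Ω} (ha : a ∈ A) (h : A.valuation (b - a) < 1) : b ∈ A := by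
  have : b - a ∈ A := (A.valuation_le_one_iff _).1 h.le
  simpa using A.add_mem _ _ this ha

theorem valuation_eval_sub_lt {f : Polynomial Ω} (hf : ∀ i, f.coeff i ∈ A) {a b : Ω} (ha : a ∈ A)
    (h : A.valuation (b - a) < 1) : A.valuation (f.eval b - f.eval a) < 1 := by
  have hb := mem_of_sub_lt A ha h
  obtain ⟨g, rfl⟩ := exists_map_eq_of_coeff_mem A hf
  obtain ⟨c, hc⟩ := Polynomial.sub_dvd_eval_sub (⟨b, hb⟩ : A) ⟨a, ha⟩ g
  have h1 : (g.map A.subtype).eval a = A.subtype (g.eval ⟨a, ha⟩) :=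
    Polynomial.eval_map_apply (f := A.subtype) (x := (⟨a, ha⟩ : A))
  have h2 : (g.map A.subtype).eval b = A.subtype (g.eval ⟨b, hb⟩) :=
    Polynomial.eval_map_apply (f := A.subtype) (x := (⟨b, hb⟩ : A))
  rw [h1, h2, ← map_sub, hc, map_mul, map_mul]
  exact mul_lt_one_of_lt_of_le h (A.valuation_le_one c)

theorem valuation_eq_one_of_sub_lt {a b : Ω} (ha : A.valuation a = 1)
    (h : A.valuation (b - a) < 1) : A.valuation b = 1 := by
  rw [← ha]
  exact Valuation.map_eq_of_sub_lt _ (by rwa [ha])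

/-- A root of a polynomial at which the derivative is a unit is the only root in its residue
class. -/
theorem eq_of_simple_root {f : Polynomial Ω} (hf : ∀ i, f.coeff i ∈ A) {a b : Ω} (ha : a ∈ A)
    (h : A.valuation (b - a) < 1) (fa : f.eval a = 0) (fb : f.eval b = 0)
    (hd : A.valuation (f.derivative.eval a) = 1) : b = a := by
  by_contra hne
  obtain ⟨g, rfl⟩ := exists_map_eq_of_coeff_mem A hf
  have hd0 : b - a ≠ 0 := sub_ne_zero.2 hne
  have hdA : b - a ∈ A := (A.valuation_le_one_iff _).1 h.le
  obtain ⟨c, hc⟩ := Polynomial.binomExpansion g (⟨a, ha⟩ : A) ⟨b - a, hdA⟩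
  have hc' := congrArg A.subtype hc
  have e1 : A.subtype (g.eval (⟨a, ha⟩ + ⟨b - a, hdA⟩ : A)) = 0 := by
    rw [← Polynomial.eval_map_apply (f := A.subtype), map_add]
    simpa using fb
  have e2 : A.subtype (g.eval (⟨a, ha⟩ : A)) = 0 := by
    rw [← Polynomial.eval_map_apply (f := A.subtype)]
    simpa using fa
  have e3 : A.subtype (g.derivative.eval (⟨a, ha⟩ : A)) =
      (g.map A.subtype).derivative.eval a := by
    rw [← Polynomial.eval_map_apply (f := A.subtype), Polynomial.derivative_map]
    rfl
  rw [e1, map_add, map_add, e2, map_mul, e3, map_mul, map_pow] at hc'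
  have e4 : (g.map A.subtype).derivative.eval a = -((c : Ω) * (b - a)) := by
    have : (b - a) * ((g.map A.subtype).derivative.eval a + (c : Ω) * (b - a)) = 0 := by
      simp only [ValuationSubring.subtype_apply] at hc'
      linear_combination -hc'
    exact eq_neg_of_add_eq_zero_left ((mul_eq_zero.1 this).resolve_left hd0)
  rw [e4, Valuation.map_neg, map_mul, mul_comm] at hd
  exact (mul_lt_one_of_lt_of_le h (A.valuation_le_one c)).ne hd

/-- An element is étale over the valued field `E` if it is a root of a monic polynomial over `E°`
at which the derivative is a unit. -/
def IsEtaleElement (E : Subfield Ω) (a : Ω) : Prop :=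
  ∃ f : Polynomial Ω, f.Monic ∧ (∀ i, f.coeff i ∈ E) ∧ (∀ i, f.coeff i ∈ A) ∧ f.eval a = 0 ∧
    A.valuation (f.derivative.eval a) = 1

theorem mem_of_monic_root {f : Polynomial Ω} (hm : f.Monic) (hf : ∀ i, f.coeff i ∈ A) {a : Ω}
    (fa : f.eval a = 0) : a ∈ A := by
  obtain ⟨g, rfl⟩ := exists_map_eq_of_coeff_mem A hf
  have hg : g.Monic := Polynomial.monic_of_injective A.subtype_injective hm
  obtain ⟨b, hb⟩ := (IsIntegrallyClosed.isIntegral_iff (R := A) (K := Ω)).1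
    (⟨g, hg, by rwa [Polynomial.eval_map] at fa⟩ : IsIntegral A a)
  rw [← hb]
  exact b.2

variable {A} in
theorem IsEtaleElement.mem {E : Subfield Ω} {a : Ω} (h : IsEtaleElement A E a) : a ∈ A := by
  obtain ⟨f, hm, -, hA, h0, -⟩ := h
  exact mem_of_monic_root A hm hA h0

variable {A} in
theorem IsEtaleElement.mono {E F : Subfield Ω} (hEF : E ≤ F) {a : Ω} (h : IsEtaleElement A E a) :
    IsEtaleElement A F a := by
  obtain ⟨f, hm, hE, hA, h0, h1⟩ := h
  exact ⟨f, hm, fun i => hEF (hE i), hA, h0, h1⟩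

/-- The inclusion of the ring of integers of a subfield. -/
def integersHom (E : Subfield Ω) : integers A E →+* Ω :=
  E.subtype.comp (integers A E).subtype

theorem integersHom_injective (E : Subfield Ω) : Function.Injective (integersHom A E) :=
  E.subtype.injective.comp (integers A E).subtype_injective

theorem integersHom_mem (E : Subfield Ω) (x : integers A E) : integersHom A E x ∈ A := x.2

theorem integersHom_mem_subfield (E : Subfield Ω) (x : integers A E) : integersHom A E x ∈ E :=
  x.1.2

theorem isUnit_integers_iff (E : Subfield Ω) (x : integers A E) :
    IsUnit x ↔ A.valuation (integersHom A E x) = 1 := by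
  constructor
  · intro h
    obtain ⟨y, hy⟩ := h.exists_right_inv
    have := congrArg (fun z => A.valuation (integersHom A E z)) hy
    simp only [map_mul, map_one] at this
    have hx := (A.valuation_le_one_iff _).2 (integersHom_mem A E x)
    have hy := (A.valuation_le_one_iff _).2 (integersHom_mem A E y)
    refine hx.antisymm (not_lt.1 fun hlt => ?_)
    exact (mul_lt_one_of_lt_of_le hlt hy).ne this
  · intro h
    have h0 : integersHom A E x ≠ 0 := fun h0 => by simp [h0] at h
    have hinv : (integersHom A E x)⁻¹ ∈ A := by
      rw [← A.valuation_le_one_iff, map_inv₀, h, inv_one]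
    have hx : (x : E) ≠ 0 := fun h => h0 (by simp [integersHom, h])
    refine IsUnit.of_mul_eq_one ⟨(x : E)⁻¹, hinv⟩ (Subtype.ext ?_)
    exact mul_inv_cancel₀ hx

theorem mem_maximalIdeal_integers_iff (E : Subfield Ω) (x : integers A E) :
    x ∈ IsLocalRing.maximalIdeal (integers A E) ↔ A.valuation (integersHom A E x) < 1 := by
  rw [IsLocalRing.mem_maximalIdeal, mem_nonunits_iff, isUnit_integers_iff]
  exact (lt_iff_le_and_ne.trans
    (and_iff_right ((A.valuation_le_one_iff _).2 (integersHom_mem A E x)))).symm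

theorem exists_integers_map_eq {E : Subfield Ω} {f : Polynomial Ω} (hm : f.Monic)
    (hE : ∀ i, f.coeff i ∈ E) (hA : ∀ i, f.coeff i ∈ A) :
    ∃ g : (integers A E)[X], g.Monic ∧ g.map (integersHom A E) = f := by
  have : f ∈ Polynomial.lifts (integersHom A E) :=
    (Polynomial.lifts_iff_coeff_lifts f).2 fun i => ⟨⟨⟨f.coeff i, hE i⟩, hA i⟩, rfl⟩
  obtain ⟨g, hg, -, hgm⟩ := Polynomial.lifts_and_natDegree_eq_and_monic this hm
  exact ⟨g, hgm, hg⟩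

theorem coeff_map_integersHom_mem {E : Subfield Ω} (p : (integers A E)[X]) (i : ℕ) :
    (p.map (integersHom A E)).coeff i ∈ A := by
  rw [Polynomial.coeff_map]
  exact integersHom_mem A E _

theorem coeff_map_integersHom_mem_subfield {E : Subfield Ω} (p : (integers A E)[X]) (i : ℕ) :
    (p.map (integersHom A E)).coeff i ∈ E := by
  rw [Polynomial.coeff_map]
  exact integersHom_mem_subfield A E _

/-- An approximate simple root always lifts to an exact one in Ω, unique in its residue class, so
Hensel's lemma for E only asks that this root lie in E. In this form the condition is stable under
intersections. -/
theorem isHenselian_iff [IsAlgClosed Ω] (E : Subfield Ω) :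
    IsHenselian A E ↔
      ∀ a, IsEtaleElement A E a → (∃ b ∈ E, A.valuation (b - a) < 1) → a ∈ E := by
  constructor
  · rintro h a ha ⟨b, hbE, hb⟩
    have haA := ha.mem
    obtain ⟨f, hm, hE, hA, h0, h1⟩ := ha
    obtain ⟨g, hgm, rfl⟩ := exists_integers_map_eq A hm hE hA
    have hbA : b ∈ A := mem_of_sub_lt A haA hb
    let b' : integers A E := ⟨⟨b, hbE⟩, hbA⟩
    have hb' : integersHom A E b' = b := rfl
    obtain ⟨c, hc, hcb⟩ := h.is_henselian g hgm b'
      (by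
        rw [mem_maximalIdeal_integers_iff, ← Polynomial.eval_map_apply, hb', ← sub_zero (eval _ _),
          ← h0]
        exact valuation_eval_sub_lt A hA haA hb)
      (by
        rw [isUnit_integers_iff, ← Polynomial.eval_map_apply, hb', ← Polynomial.derivative_map]
        exact valuation_eq_one_of_sub_lt A h1
          (valuation_eval_sub_lt A (derivative_coeff_mem A hA) haA hb))
    rw [mem_maximalIdeal_integers_iff, map_sub, hb'] at hcb
    have hca : A.valuation (integersHom A E c - a) < 1 := by
      rw [← sub_add_sub_cancel _ b a]
      exact Valuation.map_add_lt _ hcb hb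
    rw [← eq_of_simple_root A hA haA hca h0
      (by rw [Polynomial.eval_map_apply, hc.eq_zero, map_zero]) h1]
    exact integersHom_mem_subfield A E c
  · intro h
    refine ⟨fun g hgm b hb hb' => ?_⟩
    set f := g.map (integersHom A E) with hf
    have hfA : ∀ i, f.coeff i ∈ A := coeff_map_integersHom_mem A g
    have hfE : ∀ i, f.coeff i ∈ E := coeff_map_integersHom_mem_subfield A g
    have hfm : f.Monic := hgm.map _
    rw [mem_maximalIdeal_integers_iff, ← Polynomial.eval_map_apply, ← hf] at hb
    rw [isUnit_integers_iff, ← Polynomial.eval_map_apply, ← Polynomial.derivative_map, ← hf] at hb'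
    have hs := IsAlgClosed.splits f
    -- f(b) is the product of the differences b − a over the roots; if no factor were a non-unit,
    -- neither would be f(b).
    obtain ⟨a, haf, hab⟩ : ∃ a ∈ f.roots, A.valuation (integersHom A E b - a) < 1 := by
      by_contra! hcon
      rw [hs.eval_eq_prod_roots_of_monic hfm, map_multiset_prod] at hb
      refine hb.not_ge (Multiset.one_le_prod fun x hx => ?_)
      simp only [Multiset.map_map, Multiset.mem_map, Function.comp_apply] at hx
      obtain ⟨a, ha, rfl⟩ := hx
      exact hcon a ha
    have fa : f.eval a = 0 := (Polynomial.mem_roots'.1 haf).2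
    have haA := mem_of_monic_root A hfm hfA fa
    have hab' : A.valuation (a - integersHom A E b) < 1 := by rwa [Valuation.map_sub_swap]
    have h1 := valuation_eq_one_of_sub_lt A hb'
      (valuation_eval_sub_lt A (derivative_coeff_mem A hfA) (integersHom_mem A E b) hab')
    have haE := h a ⟨f, hfm, hfE, hfA, fa, h1⟩ ⟨_, integersHom_mem_subfield A E b, hab⟩
    refine ⟨⟨⟨a, haE⟩, haA⟩, integersHom_injective A E ?_, ?_⟩
    · rw [← Polynomial.eval_map_apply, map_zero]
      exact fa
    · rw [mem_maximalIdeal_integers_iff, map_sub]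
      exact hab'

/-- The map of residue fields induced by the inclusion of a valued subfield. -/
noncomputable def residueHom (E : Subfield Ω) :
    IsLocalRing.ResidueField (integers A E) →+* IsLocalRing.ResidueField A :=
  haveI : IsLocalHom ((integersHom A E).codRestrict A (integersHom_mem A E)) := ⟨fun x hx => by
    rw [isUnit_integers_iff]
    exact (A.valuation_eq_one_iff _).1 hx⟩
  IsLocalRing.ResidueField.map ((integersHom A E).codRestrict A (integersHom_mem A E))

theorem residueHom_residue (E : Subfield Ω) (x : integers A E) :
    residueHom A E (IsLocalRing.residue _ x) =
      IsLocalRing.residue A ⟨integersHom A E x, integersHom_mem A E x⟩ := rfl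

theorem residue_eq_residue_iff (x y : A) :
    IsLocalRing.residue A x = IsLocalRing.residue A y ↔ A.valuation ((x : Ω) - y) < 1 := by
  rw [← sub_eq_zero, ← map_sub, IsLocalRing.residue_eq_zero_iff, A.valuation_lt_one_iff]
  rfl

theorem eval₂_residueHom {E : Subfield Ω} (p : (integers A E)[X]) {a : Ω} (ha : a ∈ A) :
    (p.map (IsLocalRing.residue (integers A E))).eval₂ (residueHom A E)
        (IsLocalRing.residue A ⟨a, ha⟩) =
      IsLocalRing.residue A ⟨(p.map (integersHom A E)).eval a,
        eval_mem A (coeff_map_integersHom_mem A p) ha⟩ := by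
  induction p using Polynomial.induction_on' with
  | add p q hp hq =>
    rw [Polynomial.map_add, Polynomial.eval₂_add, hp, hq, ← map_add]
    congr 1
    exact Subtype.ext (by simp)
  | monomial n c =>
    rw [Polynomial.map_monomial, Polynomial.eval₂_monomial, ← map_pow, residueHom_residue,
      ← map_mul]
    congr 1
    exact Subtype.ext (by simp)

theorem eval₂_residueHom_eq_zero_iff {E : Subfield Ω} (p : (integers A E)[X]) {a : Ω}
    (ha : a ∈ A) :
    (p.map (IsLocalRing.residue (integers A E))).eval₂ (residueHom A E)
        (IsLocalRing.residue A ⟨a, ha⟩) = 0 ↔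
      A.valuation ((p.map (integersHom A E)).eval a) < 1 := by
  rw [eval₂_residueHom, IsLocalRing.residue_eq_zero_iff, A.valuation_lt_one_iff]

/-- The residue of an étale element is separable over the residue field of E; if that field is
separably closed, the element is congruent to one of E, and henselianity applies. Conversely, a root
in Ω of a monic lift of a separable polynomial is étale, so it lies in E and its residue is the
required root. -/
theorem isStrictlyHenselian_iff [IsAlgClosed Ω] (E : Subfield Ω) :
    IsStrictlyHenselian A E ↔ ∀ a, IsEtaleElement A E a → a ∈ E := by
  constructor
  · rintro ⟨h, hsep⟩ a ha
    refine (isHenselian_iff A E).1 h a ha ?_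
    have haA := ha.mem
    obtain ⟨f, hm, hE, hA, h0, h1⟩ := ha
    obtain ⟨g, hgm, rfl⟩ := exists_integers_map_eq A hm hE hA
    let _ : Algebra (IsLocalRing.ResidueField (integers A E)) (IsLocalRing.ResidueField A) :=
      (residueHom A E).toAlgebra
    set r := IsLocalRing.residue A ⟨a, haA⟩ with hr
    have e0 : Polynomial.aeval r (g.map (IsLocalRing.residue (integers A E))) = 0 :=
      (eval₂_residueHom_eq_zero_iff A g haA).2 (by simp [h0])
    have e1 : Polynomial.aeval r
        (Polynomial.derivative (g.map (IsLocalRing.residue (integers A E)))) ≠ 0 := by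
      rw [Polynomial.derivative_map]
      refine (eval₂_residueHom_eq_zero_iff A _ haA).not.2 ?_
      rw [← Polynomial.derivative_map, h1]
      exact lt_irrefl _
    have hint : IsIntegral (IsLocalRing.ResidueField (integers A E)) r :=
      ⟨_, hgm.map _, e0⟩
    have hsepr : (minpoly (IsLocalRing.ResidueField (integers A E)) r).Separable := by
      obtain ⟨q, hq⟩ := minpoly.dvd _ _ e0
      rw [Polynomial.separable_iff_derivative_ne_zero (minpoly.irreducible hint)]
      intro hd
      apply e1
      rw [hq, Polynomial.derivative_mul, hd, zero_mul, zero_add, map_mul, minpoly.aeval, zero_mul]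
    have hdeg := IsSepClosed.degree_eq_one_of_irreducible
      (IsLocalRing.ResidueField (integers A E)) (minpoly.irreducible hint) hsepr
    obtain ⟨s, hs⟩ := (minpoly.degree_eq_one_iff).1 hdeg
    obtain ⟨b, rfl⟩ := IsLocalRing.residue_surjective s
    refine ⟨integersHom A E b, integersHom_mem_subfield A E b, ?_⟩
    exact (residue_eq_residue_iff A ⟨_, integersHom_mem A E b⟩ ⟨a, haA⟩).1 hs
  · intro h
    refine ⟨(isHenselian_iff A E).2 fun a ha _ => h a ha, ?_⟩
    refine IsSepClosed.of_exists_root _ fun p hpm hpi hps => ?_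
    obtain ⟨g, hg, -, hgm⟩ := Polynomial.lifts_and_natDegree_eq_and_monic
      (Polynomial.mem_lifts_of_surjective (f := IsLocalRing.residue (integers A E))
        IsLocalRing.residue_surjective p) hpm
    set f := g.map (integersHom A E) with hf
    have hfA : ∀ i, f.coeff i ∈ A := coeff_map_integersHom_mem A g
    have hfE : ∀ i, f.coeff i ∈ E := coeff_map_integersHom_mem_subfield A g
    have hfm : f.Monic := hgm.map _
    have hfdeg : f.degree ≠ 0 := by
      rw [hf, hgm.degree_map, ← hgm.degree_map (IsLocalRing.residue (integers A E)), hg]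
      exact (Polynomial.degree_pos_of_irreducible hpi).ne'
    obtain ⟨a, ha⟩ := IsAlgClosed.exists_root f hfdeg
    have haA := mem_of_monic_root A hfm hfA ha
    have h1 : A.valuation (f.derivative.eval a) = 1 := by
      refine le_antisymm ((A.valuation_le_one_iff _).2
        (eval_mem A (derivative_coeff_mem A hfA) haA)) (not_lt.1 fun hlt => ?_)
      rw [hf, Polynomial.derivative_map, ← eval₂_residueHom_eq_zero_iff A _ haA,
        ← Polynomial.derivative_map, hg] at hlt
      refine hps.eval₂_derivative_ne_zero (residueHom A E) ?_ hlt
      rw [← hg, eval₂_residueHom_eq_zero_iff A _ haA, ← hf, ha.eq_zero]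
      simp
    have haE := h a ⟨f, hfm, hfE, hfA, ha, h1⟩
    refine ⟨IsLocalRing.residue _ ⟨⟨a, haE⟩, haA⟩, ?_⟩
    rw [← hg, Polynomial.eval_map_apply]
    have : g.eval (⟨⟨a, haE⟩, haA⟩ : integers A E) = 0 := integersHom_injective A E (by
      rw [← Polynomial.eval_map_apply, map_zero]
      exact ha)
    rw [this, map_zero]

end SimpleRoots

end ValuedSubfield

/-! ### Elements integral over a valuation ring -/

namespace ValuationSubring

section Integral

variable {F : Type v} {Ω : Type u} [Field F] [Field Ω] [Algebra F Ω]

theorem minpoly_coeff_mem_of_isIntegral {R : ValuationSubring F} {y : Ω} (h : IsIntegral R y)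
    (i : ℕ) : (minpoly F y).coeff i ∈ R := by
  rw [minpoly.isIntegrallyClosed_eq_field_fractions' F h, Polynomial.coeff_map]
  exact SetLike.coe_mem _

/-- The integral closure of a subring in a field is the intersection of the valuation rings
containing that subring. -/
theorem isIntegral_of_forall_mem {R : ValuationSubring F} {y : Ω}
    (h : ∀ B : ValuationSubring Ω, (∀ r ∈ R, algebraMap F Ω r ∈ B) → y ∈ B) :
    IsIntegral R y := by
  have hy : y ∈ (integralClosure (Subring.closure (algebraMap F Ω '' R)) Ω).toSubring := by
    rw [← iInf_valuationSubring_superset, Subring.mem_iInf]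
    rintro ⟨B, hB⟩
    exact h B fun r hr => hB ⟨r, hr, rfl⟩
  obtain ⟨p, hp, hpy⟩ : IsIntegral (Subring.closure (algebraMap F Ω '' R)) y := hy
  have hlift : p.map (algebraMap _ Ω) ∈ Polynomial.lifts (algebraMap R Ω) := by
    rw [Polynomial.lifts_iff_coeff_lifts]
    intro n
    rw [Polynomial.coeff_map]
    have hle : Subring.closure (algebraMap F Ω '' R) ≤ (algebraMap R Ω).range :=
      Subring.closure_le.2 (by rintro _ ⟨r, hr, rfl⟩; exact ⟨⟨r, hr⟩, rfl⟩)
    exact hle (p.coeff n).2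
  obtain ⟨q, hq, -, hqm⟩ := Polynomial.lifts_and_natDegree_eq_and_monic hlift (hp.map _)
  refine ⟨q, hqm, ?_⟩
  rw [← Polynomial.eval_map, hq, Polynomial.eval_map, hpy]

theorem isIntegral_of_minpoly_coeff_mem {R : ValuationSubring F} {y : Ω} (hy : IsIntegral F y)
    (h : ∀ i, (minpoly F y).coeff i ∈ R) : IsIntegral R y := by
  have hlift : minpoly F y ∈ Polynomial.lifts (algebraMap R F) :=
    (Polynomial.lifts_iff_coeff_lifts _).2 fun i => ⟨⟨_, h i⟩, rfl⟩
  obtain ⟨q, hq, -, hqm⟩ := Polynomial.lifts_and_natDegree_eq_and_monic hlift (minpoly.monic hy)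
  refine ⟨q, hqm, ?_⟩
  rw [IsScalarTower.algebraMap_eq R F Ω, ← Polynomial.eval₂_map, hq]
  exact minpoly.aeval F y

theorem mem_of_isIntegral {R : ValuationSubring F} {y : Ω} (hy : IsIntegral R y)
    (B : ValuationSubring Ω) (hB : ∀ r ∈ R, algebraMap F Ω r ∈ B) : y ∈ B := by
  obtain ⟨q, hqm, hq⟩ := hy
  refine ValuedSubfield.mem_of_monic_root B (hqm.map (algebraMap R Ω)) (fun i => ?_)
    (by rwa [Polynomial.eval_map])
  rw [Polynomial.coeff_map]
  exact hB _ (q.coeff i).2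

/-- Every integer of an algebraic extension is a fraction of elements integral over the base, with
denominator a unit. -/
theorem exists_isIntegral_mul (A : ValuationSubring Ω) {x : Ω} (hx : x ∈ A)
    (halg : IsAlgebraic F x) :
    ∃ y ∈ IntermediateField.adjoin F {x}, A.valuation y = 1 ∧
      IsIntegral (A.comap (algebraMap F Ω)) y ∧ IsIntegral (A.comap (algebraMap F Ω)) (x * y) := by
  obtain ⟨p, hp0, hpx⟩ := halg
  let w : ℕ → A.ValueGroup := fun i => A.valuation (algebraMap F Ω (p.coeff i))
  -- A coefficient of maximal value is chosen, with the largest index among ties: after division by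
  -- it all coefficients are integers and those of index above j are non-units.
  obtain ⟨j, hj, hmax⟩ := Finset.exists_max_image p.support (fun i => toLex (w i, i))
    (Polynomial.support_nonempty.2 hp0)
  have hcj : p.coeff j ≠ 0 := Polynomial.mem_support_iff.1 hj
  have hwj : w j ≠ 0 := by simpa [w] using hcj
  let c : ℕ → F := fun i => p.coeff i / p.coeff j
  have hvc : ∀ i, A.valuation (algebraMap F Ω (c i)) = w i / w j := fun i => by
    simp only [c, w, map_div₀]
  have hlex : ∀ i, w i < w j ∨ w i = w j ∧ i ≤ j := fun i => by
    by_cases hi : i ∈ p.support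
    · simpa [Prod.Lex.toLex_le_toLex] using hmax i hi
    · left
      have : w i = 0 := by simp [w, Polynomial.notMem_support_iff.1 hi]
      rw [this]
      exact zero_lt_iff.2 hwj
  have hc1 : ∀ i, c i ∈ A.comap (algebraMap F Ω) := fun i => by
    rw [ValuationSubring.mem_comap, ← A.valuation_le_one_iff, hvc]
    exact (div_le_one₀ (zero_lt_iff.2 hwj)).2 ((hlex i).elim le_of_lt fun h => h.1.le)
  have hc2 : ∀ i, j < i → A.valuation (algebraMap F Ω (c i)) < 1 := fun i hi => by
    rw [hvc]
    exact (div_lt_one₀ (zero_lt_iff.2 hwj)).2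
      ((hlex i).resolve_right fun h => absurd h.2 (not_le.2 hi))
  set n := p.natDegree with hn
  have hjn : j ≤ n := Polynomial.le_natDegree_of_mem_supp j hj
  have hsum : ∑ i ∈ Finset.range (n + 1), algebraMap F Ω (c i) * x ^ i = 0 := by
    rw [Polynomial.aeval_eq_sum_range] at hpx
    have : ∑ i ∈ Finset.range (n + 1), algebraMap F Ω (c i) * x ^ i =
        (algebraMap F Ω (p.coeff j))⁻¹ * ∑ i ∈ Finset.range (n + 1), p.coeff i • x ^ i := by
      rw [Finset.mul_sum]
      refine Finset.sum_congr rfl fun i _ => ?_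
      rw [Algebra.smul_def, map_div₀]
      ring
    rw [this, hpx, mul_zero]
  -- y is the part of the relation from index j on, divided by x^j. Its constant term is 1 and its
  -- other terms are non-units, so v(y) = 1.
  set y := ∑ i ∈ Finset.Ico j (n + 1), algebraMap F Ω (c i) * x ^ (i - j) with hy
  have hxy : x ^ j * y = -∑ i ∈ Finset.range j, algebraMap F Ω (c i) * x ^ i := by
    rw [← Finset.sum_range_add_sum_Ico _ (Nat.le_succ_of_le hjn)] at hsum
    rw [eq_neg_iff_add_eq_zero, add_comm, ← hsum, hy, Finset.mul_sum]
    congr 1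
    refine Finset.sum_congr rfl fun i hi => ?_
    rw [mul_left_comm, ← pow_add, Nat.add_sub_cancel' (Finset.mem_Ico.1 hi).1]
  -- If x ∈ B, then y is a polynomial in x over B. Otherwise x⁻¹ ∈ B, and the part of the relation
  -- below j writes xy as a polynomial in x⁻¹.
  have hyB : ∀ B : ValuationSubring Ω,
      (∀ r ∈ A.comap (algebraMap F Ω), algebraMap F Ω r ∈ B) → y ∈ B ∧ x * y ∈ B := by
    intro B hB
    by_cases hxB : x ∈ B
    · have : y ∈ B := sum_mem fun i _ => B.mul_mem _ _ (hB _ (hc1 i)) (pow_mem hxB _)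
      exact ⟨this, B.mul_mem _ _ hxB this⟩
    · have hx0 : x ≠ 0 := fun h => hxB (h ▸ B.zero_mem)
      have hxi : x⁻¹ ∈ B := (B.mem_or_inv_mem x).resolve_left hxB
      have e1 : x * y = -∑ i ∈ Finset.range j, algebraMap F Ω (c i) * x⁻¹ ^ (j - i - 1) := by
        have h2 : x ^ j * (x * y) =
            x ^ j * -∑ i ∈ Finset.range j, algebraMap F Ω (c i) * x⁻¹ ^ (j - i - 1) := by
          rw [mul_left_comm, hxy, mul_neg, mul_neg, Finset.mul_sum, Finset.mul_sum]
          congr 1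
          refine Finset.sum_congr rfl fun i hi => ?_
          have hij := Finset.mem_range.1 hi
          obtain ⟨k, rfl⟩ : ∃ k, j = i + k + 1 := ⟨j - i - 1, by omega⟩
          rw [show i + k + 1 - i - 1 = k by omega, inv_pow]
          field_simp
          ring
        exact mul_left_cancel₀ (pow_ne_zero j hx0) h2
      have hxyB : x * y ∈ B := by
        rw [e1]
        exact B.neg_mem _ (sum_mem fun i _ => B.mul_mem _ _ (hB _ (hc1 i)) (pow_mem hxi _))
      refine ⟨?_, hxyB⟩
      have := B.mul_mem _ _ hxi hxyB
      rwa [inv_mul_cancel_left₀ hx0] at this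
  refine ⟨y, ?_, ?_, isIntegral_of_forall_mem fun B hB => (hyB B hB).1,
    isIntegral_of_forall_mem fun B hB => (hyB B hB).2⟩
  · exact sum_mem fun i _ => MulMemClass.mul_mem (IntermediateField.algebraMap_mem _ _)
      (pow_mem (IntermediateField.mem_adjoin_simple_self F x) _)
  · refine ValuedSubfield.valuation_eq_one_of_sub_lt A (map_one A.valuation) ?_
    have e : y - 1 = ∑ i ∈ Finset.Ico (j + 1) (n + 1), algebraMap F Ω (c i) * x ^ (i - j) := by
      rw [hy, Finset.sum_eq_sum_Ico_succ_bot (Nat.lt_succ_of_le hjn)]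
      simp [c, hcj]
    rw [e]
    refine Valuation.map_sum_lt _ one_ne_zero fun i hi => ?_
    rw [map_mul, map_pow]
    exact mul_lt_one_of_lt_of_le (hc2 i (Finset.mem_Ico.1 hi).1)
      (pow_le_one₀ zero_le ((A.valuation_le_one_iff x).2 hx))

end Integral

end ValuationSubring

/-! ### Automorphisms over a henselian field -/

namespace ValuedSubfield

section Henselian

variable {Ω : Type u} [Field Ω] {A : ValuationSubring Ω}

theorem mem_of_isIntegral_integers {E : Subfield Ω} {y : Ω}
    (hy : IsIntegral (A.comap (algebraMap E Ω)) y) : y ∈ A :=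
  ValuationSubring.mem_of_isIntegral hy A fun _ hr => hr

theorem isIntegral_integers_of_isConjRoot {E : Subfield Ω} [Algebra.IsAlgebraic E Ω] {x y : Ω}
    (hx : IsIntegral (A.comap (algebraMap E Ω)) x) (h : IsConjRoot E x y) :
    IsIntegral (A.comap (algebraMap E Ω)) y :=
  ValuationSubring.isIntegral_of_minpoly_coeff_mem (Algebra.IsIntegral.isIntegral y) (by
    rw [← show minpoly E x = minpoly E y from h]
    exact ValuationSubring.minpoly_coeff_mem_of_isIntegral hx)

variable [IsAlgClosed Ω]

instance normal_of_isAlgClosed {F : Type v} [Field F] [Algebra F Ω] [Algebra.IsAlgebraic F Ω] :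
    Normal F Ω :=
  haveI : IsAlgClosure F Ω := ⟨inferInstance, inferInstance⟩
  IsAlgClosure.normal F Ω

variable (A) in
-- The criterion `isHenselian_iff` passes to intersections, so the infimum is itself henselian.
theorem isHenselian_henselization (k : Subfield Ω) : IsHenselian A (henselization A k) := by
  rw [isHenselian_iff]
  rintro a ha ⟨b, hb, hab⟩
  rw [henselization, Subfield.mem_sInf] at hb ⊢
  exact fun E hE => (isHenselian_iff A E).1 hE.2 a
    (ha.mono (sInf_le (show E ∈ {E | k ≤ E ∧ IsHenselian A E} from hE))) ⟨b, hb E hE, hab⟩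

variable (A) in
theorem isStrictlyHenselian_maxUnramified (k : Subfield Ω) :
    IsStrictlyHenselian A (maxUnramified A k) := by
  rw [isStrictlyHenselian_iff]
  intro a ha
  rw [maxUnramified, Subfield.mem_sInf]
  exact fun E hE => (isStrictlyHenselian_iff A E).1 hE.2 a
    (ha.mono (sInf_le (show E ∈ {E | k ≤ E ∧ IsStrictlyHenselian A E} from hE)))

variable (A) in
theorem henselization_le_maxUnramified (k : Subfield Ω) :
    henselization A k ≤ maxUnramified A k :=
  sInf_le ⟨le_maxUnramified A k, (isStrictlyHenselian_maxUnramified A k).1⟩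

variable (A) in
theorem maxUnramified_eq_of_le {k m : Subfield Ω} (hk : k ≤ m) (hm : m ≤ maxUnramified A k) :
    maxUnramified A m = maxUnramified A k :=
  le_antisymm (sInf_le ⟨hm, isStrictlyHenselian_maxUnramified A k⟩)
    (sInf_le ⟨hk.trans (le_maxUnramified A m), isStrictlyHenselian_maxUnramified A m⟩)

/-- An integral separable element all of whose other conjugates are non-units lies in the
henselian base field if it is a unit. -/
theorem IsHenselian.mem_of_conj {E : Subfield Ω} [Algebra.IsAlgebraic E Ω] (hE : IsHenselian A E)
    {z : Ω} (hz : IsIntegral (A.comap (algebraMap E Ω)) z) (hsep : IsSeparable E z)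
    (h1 : A.valuation z = 1) (hconj : ∀ τ : Ω ≃ₐ[E] Ω, τ z = z ∨ A.valuation (τ z) < 1) :
    z ∈ E := by
  classical
  have hzi : IsIntegral E z := Algebra.IsIntegral.isIntegral z
  set f := (minpoly E z).map (algebraMap E Ω) with hf
  have hfm : f.Monic := (minpoly.monic hzi).map _
  have hfE : ∀ i, f.coeff i ∈ E := fun i => by
    rw [hf, Polynomial.coeff_map]
    exact SetLike.coe_mem _
  have hfA : ∀ i, f.coeff i ∈ A := fun i => by
    rw [hf, Polynomial.coeff_map]
    exact ValuationSubring.minpoly_coeff_mem_of_isIntegral hz i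
  have hfz : f.eval z = 0 := by rw [hf, Polynomial.eval_map]; exact minpoly.aeval E z
  have hzr : z ∈ f.roots := (Polynomial.mem_roots hfm.ne_zero).2 hfz
  have hsp := IsAlgClosed.splits f
  have hnd : f.roots.Nodup := Polynomial.nodup_roots (Polynomial.Separable.map hsep)
  have hother : ∀ r ∈ f.roots.erase z, A.valuation r < 1 := fun r hr => by
    rw [hnd.mem_erase_iff] at hr
    have hr0 : Polynomial.aeval r (minpoly E z) = 0 := by
      have := (Polynomial.mem_roots'.1 hr.2).2
      rwa [hf, Polynomial.IsRoot, Polynomial.eval_map] at this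
    obtain ⟨τ, rfl⟩ := isConjRoot_iff_exists_algEquiv.1 (isConjRoot_of_aeval_eq_zero hzi hr0).symm
    exact (hconj τ).resolve_left hr.1
  -- All other roots r are non-units, so f'(z) = ∏ (z − r) is a unit, and the sum of the roots is an
  -- element of E congruent to z.
  refine (isHenselian_iff A E).1 hE z ⟨f, hfm, hfE, hfA, hfz, ?_⟩ ⟨f.roots.sum, ?_, ?_⟩
  · rw [hsp.eval_root_derivative hfm hzr, map_multiset_prod, Multiset.map_map]
    refine Multiset.prod_eq_one fun x hx => ?_
    obtain ⟨r, hr, rfl⟩ := Multiset.mem_map.1 hx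
    refine valuation_eq_one_of_sub_lt A h1 ?_
    simpa using hother r hr
  · rw [← neg_mem_iff, ← hsp.nextCoeff_eq_neg_sum_roots_of_monic hfm, Polynomial.nextCoeff]
    split_ifs
    exacts [E.zero_mem, hfE _]
  · rw [← Multiset.cons_erase hzr, Multiset.sum_cons, add_sub_cancel_left]
    have : ∀ s : Multiset Ω, (∀ r ∈ s, A.valuation r < 1) → A.valuation s.sum < 1 := by
      intro s
      induction s using Multiset.induction_on with
      | empty => simp
      | cons a s ih =>
        intro h
        rw [Multiset.sum_cons]
        exact Valuation.map_add_lt _ (h a (Multiset.mem_cons_self a s))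
          (ih fun r hr => h r (Multiset.mem_cons_of_mem hr))
    exact this _ hother

/-- Let z be the product of the unit conjugates of x. An automorphism either permutes these, fixing
z, or turns one into a non-unit, making z a non-unit. Hence z ∈ E by `mem_of_conj`; then σz = z
rules out the second case for σ, and x is one of the permuted conjugates. -/
theorem IsHenselian.valuation_algEquiv_eq_one {E : Subfield Ω} [Algebra.IsAlgebraic E Ω]
    (hE : IsHenselian A E) {x : Ω} (hx : IsIntegral (A.comap (algebraMap E Ω)) x)
    (hsep : IsSeparable E x) (h1 : A.valuation x = 1) (σ : Ω ≃ₐ[E] Ω) :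
    A.valuation (σ x) = 1 := by
  classical
  have hxi : IsIntegral E x := Algebra.IsIntegral.isIntegral x
  have hconj : ∀ τ : Ω ≃ₐ[E] Ω, ∀ c, IsConjRoot E x c → IsConjRoot E x (τ c) := fun τ c hc =>
    hc.trans (isConjRoot_iff_exists_algEquiv.2 ⟨τ, rfl⟩).symm
  have hle : ∀ c, IsConjRoot E x c → A.valuation c ≤ 1 := fun c hc =>
    (A.valuation_le_one_iff c).2
      (mem_of_isIntegral_integers (isIntegral_integers_of_isConjRoot hx hc))
  set T : Finset Ω := ((minpoly E x).aroots Ω).toFinset.filter (A.valuation · = 1) with hT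
  have hmem : ∀ c, c ∈ T ↔ IsConjRoot E x c ∧ A.valuation c = 1 := fun c => by
    rw [hT, Finset.mem_filter, Multiset.mem_toFinset, isConjRoot_iff_mem_minpoly_aroots hxi]
  set z := ∏ c ∈ T, c with hz
  have hz1 : A.valuation z = 1 := by
    rw [hz, map_prod]
    exact Finset.prod_eq_one fun c hc => ((hmem c).1 hc).2
  have hτz : ∀ τ : Ω ≃ₐ[E] Ω, (∀ c ∈ T, τ c ∈ T) ∧ τ z = z ∨
      (∃ c ∈ T, τ c ∉ T) ∧ A.valuation (τ z) < 1 := by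
    intro τ
    by_cases h : ∀ c ∈ T, τ c ∈ T
    · refine .inl ⟨h, ?_⟩
      rw [hz, map_prod]
      exact Finset.prod_nbij τ h τ.injective.injOn
        (Finset.surjOn_of_injOn_of_card_le τ h τ.injective.injOn le_rfl) fun _ _ => rfl
    · push Not at h
      obtain ⟨c, hc, hcT⟩ := h
      refine .inr ⟨⟨c, hc, hcT⟩, ?_⟩
      rw [hz, map_prod, map_prod, ← Finset.mul_prod_erase _ _ hc]
      have hc' := hconj τ c ((hmem c).1 hc).1
      refine mul_lt_one_of_lt_of_le
        (lt_of_le_of_ne (hle _ hc') fun h => hcT ((hmem _).2 ⟨hc', h⟩)) ?_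
      exact Finset.prod_le_one' fun d hd =>
        hle _ (hconj τ d ((hmem d).1 (Finset.mem_of_mem_erase hd)).1)
  have hzE : z ∈ E := by
    refine hE.mem_of_conj (IsIntegral.prod _ fun c hc =>
      isIntegral_integers_of_isConjRoot hx ((hmem c).1 hc).1) ?_ hz1
      fun τ => (hτz τ).imp And.right And.right
    rw [← mem_separableClosure_iff]
    exact prod_mem fun c hc => mem_separableClosure_iff.2 (by
      have : minpoly E x = minpoly E c := ((hmem c).1 hc).1
      rwa [IsSeparable, ← this])
  have hσz : σ z = z := σ.commutes ⟨z, hzE⟩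
  rcases hτz σ with h | h
  · exact ((hmem _).1 (h.1 x ((hmem x).2 ⟨.refl, h1⟩))).2
  · rw [hσz, hz1] at h
    exact absurd h.2 (lt_irrefl _)

/-- An automorphism over a henselian field preserves the valuation ring. -/
theorem IsHenselian.map_mem {E : Subfield Ω} [Algebra.IsAlgebraic E Ω] (hE : IsHenselian A E)
    (σ : Ω ≃ₐ[E] Ω) {x : Ω} (hx : x ∈ A) : σ x ∈ A := by
  obtain ⟨p, hp⟩ := ExpChar.exists E
  have : ExpChar (separableClosure E Ω) p := expChar_of_injective_algebraMap
    (algebraMap E (separableClosure E Ω)).injective p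
  -- A p-power of x is separable, and membership in A is unaffected by taking powers.
  obtain ⟨n, ⟨s, hs⟩⟩ := IsPurelyInseparable.pow_mem (separableClosure E Ω) p x
  have hs : IsSeparable E (x ^ p ^ n) := mem_separableClosure_iff.1 (hs ▸ s.2)
  -- The denominator y lies in the field generated by this power, hence is separable too; σ keeps it
  -- a unit and keeps the numerator integral.
  obtain ⟨y, hy, hy1, hyi, hxyi⟩ := A.exists_isIntegral_mul (F := E) (pow_mem hx (p ^ n))
    (Algebra.IsAlgebraic.isAlgebraic _)
  have hle : IntermediateField.adjoin E {x ^ p ^ n} ≤ separableClosure E Ω :=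
    IntermediateField.adjoin_simple_le_iff.2 (mem_separableClosure_iff.2 hs)
  have h1 := hE.valuation_algEquiv_eq_one hyi (mem_separableClosure_iff.1 (hle hy)) hy1 σ
  have h2 : σ (x ^ p ^ n * y) ∈ A := mem_of_isIntegral_integers
    (isIntegral_integers_of_isConjRoot hxyi (isConjRoot_iff_exists_algEquiv.2 ⟨σ, rfl⟩).symm)
  rw [← A.valuation_le_one_iff, map_mul, map_mul, h1, mul_one, map_pow, map_pow] at h2
  rw [← A.valuation_le_one_iff]
  exact (pow_le_one_iff_of_nonneg zero_le (pow_ne_zero n (expChar_pos E p).ne')).1 h2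

theorem IsHenselian.map_mem_iff {E : Subfield Ω} [Algebra.IsAlgebraic E Ω] (hE : IsHenselian A E)
    (σ : Ω ≃ₐ[E] Ω) {x : Ω} : σ x ∈ A ↔ x ∈ A :=
  ⟨fun h => by simpa using hE.map_mem σ.symm h, hE.map_mem σ⟩

end Henselian

end ValuedSubfield

/-! ### Inertia and the strict henselization -/

namespace ValuedSubfield

section Automorphisms

variable {Ω : Type u} [Field Ω] {A : ValuationSubring Ω}

theorem isSeparable_of_derivative_ne_zero {F : Type v} [Field F] [Algebra F Ω] {a : Ω} {f : F[X]}
    (hf : f ≠ 0) (fa : Polynomial.aeval a f = 0)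
    (hd : Polynomial.aeval a (Polynomial.derivative f) ≠ 0) : IsSeparable F a := by
  have hint : IsIntegral F a := isAlgebraic_iff_isIntegral.1 ⟨f, hf, fa⟩
  obtain ⟨q, hq⟩ := minpoly.dvd _ _ fa
  rw [IsSeparable, Polynomial.separable_iff_derivative_ne_zero (minpoly.irreducible hint)]
  intro h
  apply hd
  rw [hq, Polynomial.derivative_mul, h, zero_mul, zero_add, map_mul, minpoly.aeval, zero_mul]

theorem IsEtaleElement.isSeparable {F : Type v} [Field F] [Algebra F Ω] {E : Subfield Ω} {a : Ω}
    (ha : IsEtaleElement A E a) (h : ∀ x ∈ E, x ∈ (algebraMap F Ω).range) : IsSeparable F a := by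
  obtain ⟨f, hm, hE, -, h0, h1⟩ := ha
  have : f ∈ Polynomial.lifts (algebraMap F Ω) :=
    (Polynomial.lifts_iff_coeff_lifts f).2 fun i => h _ (hE i)
  obtain ⟨g, hg, -, hgm⟩ := Polynomial.lifts_and_natDegree_eq_and_monic this hm
  refine isSeparable_of_derivative_ne_zero hgm.ne_zero (f := g) ?_ ?_
  · rw [Polynomial.aeval_def, ← Polynomial.eval_map, hg, h0]
  · rw [Polynomial.aeval_def, ← Polynomial.eval_map, ← Polynomial.derivative_map, hg]
    intro h
    rw [h, map_zero] at h1
    exact zero_ne_one h1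

theorem valuation_lt_one_iff_inv {x : Ω} : A.valuation x < 1 ↔ x = 0 ∨ x⁻¹ ∉ A :=
  (A.mem_nonunits_iff).symm.trans A.mem_nonunits_iff_or

theorem residue_pow_injective {p : ℕ} [ExpChar (IsLocalRing.ResidueField A) p] (n : ℕ) {a b : Ω}
    (ha : a ∈ A) (hb : b ∈ A) (h : A.valuation (a ^ p ^ n - b ^ p ^ n) < 1) :
    A.valuation (a - b) < 1 := by
  refine (residue_eq_residue_iff A ⟨a, ha⟩ ⟨b, hb⟩).1 (iterateFrobenius_inj _ p n ?_)
  rw [iterateFrobenius_def, iterateFrobenius_def, ← map_pow, ← map_pow]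
  exact (residue_eq_residue_iff A (⟨a, ha⟩ ^ p ^ n) (⟨b, hb⟩ ^ p ^ n)).2 h

theorem isAlgebraic_of_le {E F : Subfield Ω} (h : E ≤ F) [Algebra.IsAlgebraic E Ω] :
    Algebra.IsAlgebraic F Ω :=
  letI : Algebra E F := (Subfield.inclusion h).toAlgebra
  haveI : IsScalarTower E F Ω := IsScalarTower.of_algebraMap_eq fun _ => rfl
  Algebra.IsAlgebraic.tower_top (K := E) F

variable [IsAlgClosed Ω]

theorem mem_of_forall_algEquiv_eq {F : Type v} [Field F] [Algebra F Ω] [Algebra.IsAlgebraic F Ω]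
    {a : Ω} (hsep : IsSeparable F a) (h : ∀ σ : Ω ≃ₐ[F] Ω, σ a = a) :
    a ∈ (algebraMap F Ω).range := by
  classical
  have hai : IsIntegral F a := Algebra.IsIntegral.isIntegral a
  rw [← minpoly.natDegree_eq_one_iff]
  have hroots : ∀ r ∈ (minpoly F a).aroots Ω, r = a := fun r hr => by
    obtain ⟨τ, hτ⟩ := isConjRoot_iff_exists_algEquiv.1
      ((isConjRoot_iff_mem_minpoly_aroots hai).2 hr).symm
    rw [← hτ, h]
  have hnd : ((minpoly F a).aroots Ω).Nodup := Polynomial.nodup_roots (Polynomial.Separable.map hsep)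
  have hcard : Multiset.card ((minpoly F a).aroots Ω) = (minpoly F a).natDegree := by
    rw [Polynomial.aroots, ← (IsAlgClosed.splits _).natDegree_eq_card_roots,
      Polynomial.natDegree_map]
  refine le_antisymm ?_ (minpoly.natDegree_pos hai)
  rw [← hcard, ← Multiset.count_eq_card.2 fun r hr => (hroots r hr).symm]
  exact Multiset.nodup_iff_count_le_one.1 hnd a

theorem IsHenselian.valuation_map_lt_one_iff {E : Subfield Ω} [Algebra.IsAlgebraic E Ω]
    (hE : IsHenselian A E) (σ : Ω ≃ₐ[E] Ω) {x : Ω} :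
    A.valuation (σ x) < 1 ↔ A.valuation x < 1 := by
  rw [valuation_lt_one_iff_inv, valuation_lt_one_iff_inv, ← map_inv₀, hE.map_mem_iff,
    map_eq_zero_iff σ σ.injective]

/-- View an automorphism over a field as an automorphism over a smaller field. -/
def restrictAlgEquiv {E F : Subfield Ω} (h : E ≤ F) (σ : Ω ≃ₐ[F] Ω) : Ω ≃ₐ[E] Ω :=
  AlgEquiv.ofRingEquiv (f := σ.toRingEquiv) fun x => σ.commutes ⟨x, h x.2⟩

/-- An algebraic extension of a henselian field is henselian. -/
theorem IsHenselian.mono {E F : Subfield Ω} [Algebra.IsAlgebraic E Ω] (hE : IsHenselian A E)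
    (h : E ≤ F) : IsHenselian A F := by
  have := isAlgebraic_of_le h
  rw [isHenselian_iff]
  rintro a ha ⟨b, hbF, hab⟩
  have haA := ha.mem
  obtain ⟨⟨c, hc⟩, rfl⟩ := mem_of_forall_algEquiv_eq (F := F)
    (ha.isSeparable fun x hx => ⟨⟨x, hx⟩, rfl⟩) fun σ => by
      obtain ⟨f, hm, hfF, hfA, h0, h1⟩ := ha
      refine eq_of_simple_root A hfA haA ?_ h0 ?_ h1
      -- σ fixes b and preserves non-units, so σa, like a, is congruent to b; a simple root is alone
      -- in its residue class.
      · have hσ : A.valuation (b - σ a) < 1 := by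
          have hb : σ b = b := σ.commutes ⟨b, hbF⟩
          rw [← hb, ← map_sub]
          exact (hE.valuation_map_lt_one_iff (restrictAlgEquiv h σ)).2 hab
        rw [← sub_sub_sub_cancel_left _ _ b]
        exact Valuation.map_sub_lt _ hab hσ
      · obtain ⟨g, rfl⟩ : ∃ g : F[X], g.map (algebraMap F Ω) = f :=
          (Polynomial.mem_lifts f).1
            ((Polynomial.lifts_iff_coeff_lifts f).2 fun i => ⟨⟨_, hfF i⟩, rfl⟩)
        rw [Polynomial.eval_map] at h0 ⊢
        have := Polynomial.aeval_algHom_apply σ.toAlgHom a g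
        rw [Polynomial.aeval_def, Polynomial.aeval_def, h0, map_zero] at this
        exact this
  exact hc

/-- Over a strictly henselian field every automorphism is in the inertia group. -/
theorem IsStrictlyHenselian.valuation_map_sub_lt {E : Subfield Ω} [Algebra.IsAlgebraic E Ω]
    (hE : IsStrictlyHenselian A E) (σ : Ω ≃ₐ[E] Ω) {a : Ω} (ha : a ∈ A) :
    A.valuation (σ a - a) < 1 := by
  -- The residue of b is purely inseparable over the separably closed residue field of E, so some
  -- b^(p^n) is congruent to an element c of E. As σ fixes c, injectivity of Frobenius gives σb ≡ b.
  have key : ∀ b, IsIntegral (A.comap (algebraMap E Ω)) b → A.valuation (σ b - b) < 1 := by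
    intro b hb
    have hbA := mem_of_isIntegral_integers hb
    obtain ⟨g, hgm, hg⟩ : ∃ g : (integers A E)[X], g.Monic ∧ g.eval₂ (integersHom A E) b = 0 := hb
    let κ := IsLocalRing.ResidueField (integers A E)
    let _ : Algebra κ (IsLocalRing.ResidueField A) := (residueHom A E).toAlgebra
    have : IsSepClosed κ := hE.2
    obtain ⟨p, hp⟩ := ExpChar.exists κ
    have : ExpChar (IsLocalRing.ResidueField A) p :=
      expChar_of_injective_algebraMap (algebraMap κ (IsLocalRing.ResidueField A)).injective p
    set r := IsLocalRing.residue A ⟨b, hbA⟩ with hr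
    have hint : IsIntegral κ r := ⟨_, hgm.map (IsLocalRing.residue (integers A E)), by
      refine (eval₂_residueHom_eq_zero_iff A g hbA).2 ?_
      rw [Polynomial.eval_map, hg, map_zero]
      exact zero_lt_one⟩
    have : Algebra.IsAlgebraic κ (IntermediateField.adjoin κ {r}) :=
      IntermediateField.isAlgebraic_adjoin_simple hint
    obtain ⟨n, s, hs⟩ := IsPurelyInseparable.pow_mem κ p (IntermediateField.AdjoinSimple.gen κ r)
    obtain ⟨c, rfl⟩ := IsLocalRing.residue_surjective s
    have hs' : IsLocalRing.residue A ⟨integersHom A E c, integersHom_mem A E c⟩ =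
        IsLocalRing.residue A (⟨b, hbA⟩ ^ p ^ n) := by
      rw [map_pow, ← hr, ← residueHom_residue]
      exact congrArg Subtype.val hs
    have hbc : A.valuation (integersHom A E c - b ^ p ^ n) < 1 :=
      (residue_eq_residue_iff A ⟨integersHom A E c, integersHom_mem A E c⟩ (⟨b, hbA⟩ ^ p ^ n)).1 hs'
    have hσbc : A.valuation (integersHom A E c - σ b ^ p ^ n) < 1 := by
      have hc : σ (integersHom A E c) = integersHom A E c := σ.commutes c.1
      rw [← hc, ← map_pow, ← map_sub]
      exact (hE.1.valuation_map_lt_one_iff σ).2 hbc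
    refine residue_pow_injective (p := p) n (hE.1.map_mem σ hbA) hbA ?_
    rw [← sub_sub_sub_cancel_left _ _ (integersHom A E c)]
    exact Valuation.map_sub_lt _ hbc hσbc
  obtain ⟨y, -, hy1, hyi, hayi⟩ := A.exists_isIntegral_mul (F := E) ha
    (Algebra.IsAlgebraic.isAlgebraic _)
  have h1 := key y hyi
  have h2 := key _ hayi
  have hσy : A.valuation (σ y) = 1 := valuation_eq_one_of_sub_lt A hy1 h1
  -- The general case follows by writing a = (ay)/y with ay and y integral and y a unit.
  have h3 : (σ a - a) * σ y = (σ (a * y) - a * y) - a * (σ y - y) := by rw [map_mul]; ring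
  have h4 : A.valuation ((σ a - a) * σ y) < 1 := by
    rw [h3]
    refine Valuation.map_sub_lt _ h2 ?_
    rw [map_mul, mul_comm]
    exact mul_lt_one_of_lt_of_le h1 ((A.valuation_le_one_iff a).2 ha)
  rwa [map_mul, hσy, mul_one] at h4

/-- The separable elements fixed by σ form a field over k. It is strictly henselian: if a is étale
over it, then a is separable, and σa is a root of the same polynomial in the residue class of a, so
σa = a. Hence it contains the least such field k^u. -/
theorem maxUnramified_isSeparable_and_fixed {k : Subfield Ω} [Algebra.IsAlgebraic k Ω]
    (σ : Ω ≃ₐ[k] Ω) (hσ : ∀ a ∈ A, IsSeparable k a → A.valuation (σ a - a) < 1) {x : Ω}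
    (hx : x ∈ maxUnramified A k) : IsSeparable k x ∧ σ x = x := by
  let E : Subfield Ω := (separableClosure k Ω).toSubfield ⊓ σ.toRingHom.eqLocusField (RingHom.id Ω)
  have hE : ∀ y, y ∈ E ↔ IsSeparable k y ∧ σ y = y := fun y =>
    and_congr_left fun _ => mem_separableClosure_iff
  refine (hE x).1 ((show maxUnramified A k ≤ E from sInf_le ⟨fun y hy => ?_, ?_⟩) hx)
  · exact (hE y).2 ⟨isSeparable_algebraMap (⟨y, hy⟩ : k), σ.commutes ⟨y, hy⟩⟩
  · rw [isStrictlyHenselian_iff]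
    intro a ha
    have haA := ha.mem
    have hsep : IsSeparable k a := by
      have h1 : IsSeparable (separableClosure k Ω) a :=
        ha.isSeparable fun y hy => ⟨⟨y, hy.1⟩, rfl⟩
      have h2 : a ∈ separableClosure (separableClosure k Ω) Ω := mem_separableClosure_iff.2 h1
      rw [separableClosure.separableClosure_eq_bot, IntermediateField.mem_bot] at h2
      obtain ⟨s, rfl⟩ := h2
      exact mem_separableClosure_iff.1 s.2
    refine (hE a).2 ⟨hsep, ?_⟩
    obtain ⟨f, hm, hfE, hfA, h0, h1⟩ := ha
    refine eq_of_simple_root A hfA haA (hσ a haA hsep) h0 ?_ h1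
    have hfσ : f.map σ.toRingHom = f := Polynomial.ext fun i => by
      rw [Polynomial.coeff_map]
      exact ((hE _).1 (hfE i)).2
    have := Polynomial.eval_map_apply (f := σ.toRingHom) (p := f) (x := a)
    rw [hfσ, h0, map_zero] at this
    exact this

end Automorphisms

end ValuedSubfield

/-! ### The wild inertia group of a finite Galois extension -/

/-- Since W is normal, [W : H ∩ W] = [HW : H], a factor of [G : H]. -/
theorem Subgroup.relIndex_dvd_index_of_normal_right {G : Type*} [Group G] [Finite G]
    (H W : Subgroup G) [W.Normal] : H.relIndex W ∣ H.index := by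
  have h1 := Subgroup.relIndex_mul_relIndex (H ⊓ W) W (H ⊔ W) inf_le_right le_sup_right
  have h2 := Subgroup.relIndex_mul_relIndex (H ⊓ W) H (H ⊔ W) inf_le_left le_sup_left
  rw [Subgroup.inf_relIndex_right, Subgroup.relIndex_sup_right] at h1
  rw [Subgroup.inf_relIndex_left] at h2
  have h3 : H.relIndex W = H.relIndex (H ⊔ W) := by
    refine mul_right_cancel₀ (b := W.relIndex H) Subgroup.FiniteIndex.index_ne_zero ?_
    rw [h1, ← h2, mul_comm]
  rw [h3, ← Subgroup.relIndex_mul_index (le_sup_left : H ≤ H ⊔ W)]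
  exact dvd_mul_right _ _

namespace WildInertia

variable {E M Γ : Type*} [Field E] [Field M] [Algebra E M] [LinearOrderedCommGroupWithZero Γ]
  (w : Valuation M Γ)

theorem valuation_map_eq {g : M ≃ₐ[E] M} (hg : ∀ x, x ≠ 0 → w (g x - x) < w x) (x : M) :
    w (g x) = w x := by
  by_cases hx : x = 0
  · rw [hx, map_zero]
  · exact Valuation.map_eq_of_sub_lt w (hg x hx)

/-- The automorphisms that act trivially on the graded ring of the valuation. -/
def wildInertia : Subgroup (M ≃ₐ[E] M) where
  carrier := {g | ∀ x, x ≠ 0 → w (g x - x) < w x}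
  one_mem' x hx := by simpa [zero_lt_iff] using hx
  mul_mem' {g h} hg hh x hx := by
    have h1 := hg (h x) (by simpa using hx)
    rw [valuation_map_eq w hh] at h1
    have e : (g * h) x - x = (g (h x) - h x) + (h x - x) := by
      rw [AlgEquiv.mul_apply]; ring
    rw [e]
    exact Valuation.map_add_lt w h1 (hh x hx)
  inv_mem' {g} hg x hx := by
    have h1 := hg (g⁻¹ x) (by simpa using hx)
    have h2 := valuation_map_eq w hg (g⁻¹ x)
    have h3 : g (g⁻¹ x) = x := AlgEquiv.apply_symm_apply g x
    rw [h3] at h1 h2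
    rwa [h2, Valuation.map_sub_swap]

theorem wildInertia_normal (h : ∀ (g : M ≃ₐ[E] M) x, w (g x) = w x) :
    (wildInertia w : Subgroup (M ≃ₐ[E] M)).Normal := by
  refine ⟨fun g hg τ x hx => ?_⟩
  have h1 := hg (τ⁻¹ x) (by simpa using hx)
  rw [← h τ, h τ⁻¹, map_sub] at h1
  have h3 : τ (τ⁻¹ x) = x := AlgEquiv.apply_symm_apply τ x
  rw [h3] at h1
  exact h1

theorem wildInertia_pow_sub_lt {g : M ≃ₐ[E] M} (hg : g ∈ wildInertia w) (i : ℕ) {x : M}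
    (hx : x ≠ 0) : w ((g ^ i) x - x) < w x :=
  (wildInertia w).pow_mem hg i x hx

/-- The order of an element of the wild inertia group is not invertible in the residue field. -/
theorem eq_one_of_pow_eq_one {g : M ≃ₐ[E] M} (hg : g ∈ wildInertia w) {q : ℕ} (hq : w q = 1)
    (h : g ^ q = 1) : g = 1 := by
  have hq0 : (q : M) ≠ 0 := fun h0 => by simp [h0] at hq
  have hinv : ∀ y, g (∑ i ∈ Finset.range q, (g ^ i) y) = ∑ i ∈ Finset.range q, (g ^ i) y := by
    intro y
    have h1 : g (∑ i ∈ Finset.range q, (g ^ i) y) = ∑ i ∈ Finset.range q, (g ^ (i + 1)) y := by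
      rw [map_sum]
      exact Finset.sum_congr rfl fun i _ => by rw [pow_succ', AlgEquiv.mul_apply]
    have h2 := Finset.sum_range_succ (fun i => (g ^ i) y) q
    rw [Finset.sum_range_succ'] at h2
    rw [h1]
    simpa [h] using h2
  ext y
  set t := ∑ i ∈ Finset.range q, (g ^ i) y with ht
  have hpow : ∀ i, (g ^ i) t = t := fun i => by
    induction i with
    | zero => rfl
    | succ i ih => rw [pow_succ, AlgEquiv.mul_apply, hinv, ih]
  -- The sum of the g^i x over i < q vanishes. Wild inertia makes every g^i x agree with x to
  -- leading order, so for x ≠ 0 that sum would have value w(qx) = w(x). Thus qy = t, which g fixes.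
  set x := q * y - t with hx
  have htr : ∑ i ∈ Finset.range q, (g ^ i) x = 0 := by
    simp only [hx, map_sub, hpow, Finset.sum_sub_distrib, map_mul, map_natCast, ← Finset.mul_sum,
      Finset.sum_const, Finset.card_range, nsmul_eq_mul, ← ht, sub_self]
  have hx0 : x = 0 := by
    by_contra hne
    have h1 : w (∑ i ∈ Finset.range q, ((g ^ i) x - x)) < w x :=
      Valuation.map_sum_lt w ((Valuation.ne_zero_iff w).2 hne)
        fun i _ => wildInertia_pow_sub_lt w hg i hne
    rw [Finset.sum_sub_distrib, htr, Finset.sum_const, Finset.card_range, nsmul_eq_mul, zero_sub,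
      Valuation.map_neg, map_mul, hq, one_mul] at h1
    exact lt_irrefl _ h1
  have hy : (q : M) * y = t := sub_eq_zero.1 hx0
  have hgy : (q : M) * g y = q * y := by
    have := hinv y
    rwa [← ht, ← hy, map_mul, map_natCast] at this
  exact mul_left_cancel₀ hq0 hgy

/-- Put u = gx/x, a unit. As g is trivial on residues, g^i x / x ≡ u^i, so u^q ≡ 1. Since q vanishes
in the residue field, (u − 1)^q ≡ u^q − 1 ≡ 0, whence u ≡ 1. -/
theorem mem_wildInertia_of_pow_mem {g : M ≃ₐ[E] M} (h1 : ∀ x, w (g x) = w x)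
    (h2 : ∀ x, w x ≤ 1 → w (g x - x) < 1) {q : ℕ} (hp : q.Prime) (hq : w q < 1)
    (h : g ^ q ∈ wildInertia w) : g ∈ wildInertia w := by
  intro x hx
  set u := g x / x with hu
  have hwx : w x ≠ 0 := (Valuation.ne_zero_iff w).2 hx
  have hwu : w u = 1 := by rw [hu, map_div₀, h1, div_self hwx]
  have hgx : g x = x * u := by rw [hu, mul_div_cancel₀ _ hx]
  have hpow : ∀ i, w ((g ^ i) x / x - u ^ i) < 1 := by
    intro i
    induction i with
    | zero => simp [hx]
    | succ i ih =>
      have hpi : w ((g ^ i) x / x) = 1 := by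
        have : w (u ^ i) = 1 := by rw [map_pow, hwu, one_pow]
        rw [← this]
        exact Valuation.map_eq_of_sub_lt w (by rwa [this])
      have h3 := h2 _ hpi.le
      have e : (g ^ (i + 1)) x / x - u ^ (i + 1) =
          (g ((g ^ i) x / x) - (g ^ i) x / x) * u + ((g ^ i) x / x - u ^ i) * u := by
        rw [pow_succ' g, AlgEquiv.mul_apply, map_div₀, hgx, pow_succ]
        have hu0 : u ≠ 0 := fun h0 => by simp [h0] at hwu
        field_simp
        ring
      rw [e]
      refine Valuation.map_add_lt w ?_ ?_ <;> rw [map_mul, hwu, mul_one] <;> assumption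
  have h3 : w ((g ^ q) x / x - 1) < 1 := by
    rw [div_sub_one hx, map_div₀]
    exact (div_lt_one₀ (zero_lt_iff.2 hwx)).2 (h x hx)
  have h4 : w (u ^ q - 1) < 1 := by
    rw [← sub_sub_sub_cancel_left _ _ ((g ^ q) x / x)]
    exact Valuation.map_sub_lt w h3 (hpow q)
  have hu1 : w (u - 1) ≤ 1 := (Valuation.map_sub w u 1).trans (by simp [hwu])
  obtain ⟨r, hr⟩ := exists_add_pow_prime_eq hp (⟨u - 1, hu1⟩ : w.integer) 1
  have hr' := congrArg Subtype.val hr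
  simp only [Subring.coe_pow, Subring.coe_add, Subring.coe_mul, Subring.coe_one, one_pow,
    sub_add_cancel, mul_one, Subring.coe_natCast] at hr'
  have h5 : w ((u - 1) ^ q) < 1 := by
    have e : (u - 1) ^ q = (u ^ q - 1) - q * ((u - 1) * r) := by rw [hr']; ring
    rw [e]
    refine Valuation.map_sub_lt w h4 ?_
    rw [map_mul]
    refine mul_lt_one_of_lt_of_le hq ?_
    rw [map_mul]
    exact mul_le_one' hu1 r.2
  rw [map_pow, pow_lt_one_iff_of_nonneg zero_le hp.ne_zero, hu, div_sub_one hx, map_div₀] at h5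
  exact (div_lt_one₀ (zero_lt_iff.2 hwx)).1 h5

/-- When all of the Galois group is inertia, a subgroup contains the wild inertia group if and only
if its index is invertible in the residue field. -/
theorem wildInertia_le_iff [FiniteDimensional E M] (h1 : ∀ (g : M ≃ₐ[E] M) x, w (g x) = w x)
    (h2 : ∀ (g : M ≃ₐ[E] M) x, w x ≤ 1 → w (g x - x) < 1) (H : Subgroup (M ≃ₐ[E] M)) :
    wildInertia w ≤ H ↔ ∀ q : ℕ, q.Prime → q ∣ H.index → w q = 1 := by
  have := wildInertia_normal (E := E) w h1
  have hle : ∀ n : ℕ, w (n : M) ≤ 1 := fun n => by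
    induction n with
    | zero => simp
    | succ n ih =>
      rw [Nat.cast_succ]
      exact Valuation.map_add_le w ih (map_one w).le
  constructor
  -- By Cauchy's theorem such a q yields an element of order q modulo wild inertia; if q is a
  -- non-unit, `mem_wildInertia_of_pow_mem` makes it trivial.
  · intro h q hp hq
    refine (hle q).antisymm (not_lt.1 fun hlt => ?_)
    have : Fact q.Prime := ⟨hp⟩
    obtain ⟨x, hx⟩ := exists_prime_orderOf_dvd_card' (G := (M ≃ₐ[E] M) ⧸ wildInertia w) q
      (hq.trans (Subgroup.index_dvd_of_le h))
    obtain ⟨g, rfl⟩ := QuotientGroup.mk_surjective x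
    have hgq : g ^ q ∈ wildInertia w := by
      rw [← QuotientGroup.eq_one_iff, QuotientGroup.mk_pow, ← hx, pow_orderOf_eq_one]
    have := (QuotientGroup.eq_one_iff g).2
      (mem_wildInertia_of_pow_mem w (h1 g) (h2 g) hp hlt hgq)
    rw [this, orderOf_one] at hx
    exact hp.ne_one hx.symm
  -- A prime dividing [W : W ∩ H], with W the wild inertia group, divides the index of H, so it is a
  -- unit; it is also the order of an element of W, which `eq_one_of_pow_eq_one` forbids.
  · intro h
    rw [← Subgroup.relIndex_eq_one]
    by_contra hne
    obtain ⟨q, hp, hq⟩ := Nat.exists_prime_and_dvd hne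
    have hq1 := h q hp (hq.trans (Subgroup.relIndex_dvd_index_of_normal_right H _))
    have : Fact q.Prime := ⟨hp⟩
    obtain ⟨g, hg⟩ := exists_prime_orderOf_dvd_card' (G := wildInertia (E := E) w) q
      (hq.trans (Subgroup.relIndex_dvd_card _ _))
    have hgq : (g : M ≃ₐ[E] M) ^ q = 1 := by
      rw [← Subgroup.coe_pow, ← hg, pow_orderOf_eq_one, Subgroup.coe_one]
    have hg1 : g = 1 := Subtype.ext (eq_one_of_pow_eq_one w g.2 hq1 hgq)
    rw [hg1, orderOf_one] at hg
    exact hp.ne_one hg.symm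

end WildInertia

/-! ### Linear disjointness and adjunction of subfields -/

/-- Linear disjointness is tested on finite subextensions. The one inside D may be enlarged to its
normal closure, which is finite Galois and still inside D; for it trivial intersection suffices. -/
theorem IntermediateField.LinearDisjoint.of_inf_eq_bot_of_isAlgebraic {F Ω : Type*} [Field F]
    [Field Ω] [Algebra F Ω] [Normal F Ω] {C D : IntermediateField F Ω}
    [Algebra.IsAlgebraic F C] [IsGalois F D] (h : C ⊓ D = ⊥) : C.LinearDisjoint D := by
  rw [IntermediateField.linearDisjoint_iff']
  have : Algebra.IsIntegral F C.toSubalgebra := inferInstanceAs (Algebra.IsIntegral F C)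
  have : Algebra.IsIntegral F D.toSubalgebra := inferInstanceAs (Algebra.IsIntegral F D)
  refine Subalgebra.LinearDisjoint.of_linearDisjoint_finite fun C' D' hC hD hC' hD' => ?_
  let C₁ : IntermediateField F Ω := C'.toIntermediateField' (isField_of_isIntegral_of_isField'
    (R := F) (Field.toIsField F))
  let D₁ : IntermediateField F Ω := D'.toIntermediateField' (isField_of_isIntegral_of_isField'
    (R := F) (Field.toIsField F))
  have : FiniteDimensional F C₁ := hC'
  have : FiniteDimensional F D₁ := hD'
  let N := IntermediateField.normalClosure F D₁ Ω
  have hND : N ≤ D := IntermediateField.normalClosure_le_iff_of_normal.2 hD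
  have : Algebra.IsSeparable F N := .of_algHom F D (IntermediateField.inclusion hND)
  have : IsGalois F N := ⟨⟩
  have hLD : N.LinearDisjoint C₁ := .of_inf_eq_bot (le_bot_iff.1 (by
    rw [← h, inf_comm]
    exact inf_le_inf hC hND))
  exact IntermediateField.linearDisjoint_iff'.1
    (hLD.symm.of_le_right (IntermediateField.le_normalClosure D₁))

namespace ValuedSubfield

section Degrees

variable {Ω : Type u} [Field Ω]

theorem finrank_adjoin_of_linearDisjoint {m E : Subfield Ω} (h : m ≤ E)
    {F : IntermediateField m Ω} [Algebra.IsAlgebraic m F]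
    (H : F.LinearDisjoint (Subfield.extendScalars h)) :
    Module.finrank E (IntermediateField.adjoin E (F : Set Ω)) = Module.finrank m F :=
  congrArg Cardinal.toNat H.adjoin_rank_eq_rank_left_of_isAlgebraic_left

/-- The compositum with a larger base field of a subfield finite over a smaller one is finite. -/
theorem finiteDimensional_adjoin_subfield {k l E : Subfield Ω} (hkl : k ≤ l) (hkE : k ≤ E)
    [FiniteDimensional k (Subfield.extendScalars hkl)] :
    FiniteDimensional E (IntermediateField.adjoin E (l : Set Ω)) := by
  have hfg : Algebra.EssFiniteType k (Subfield.extendScalars hkl) := inferInstance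
  obtain ⟨S, hS⟩ := IntermediateField.essFiniteType_iff.1 hfg
  have hSl : (S : Set Ω) ⊆ l := by
    have : (S : Set Ω) ⊆ Subfield.extendScalars hkl := by
      rw [← hS]; exact IntermediateField.subset_adjoin _ _
    exact this
  have hSi : ∀ x ∈ (S : Set Ω), IsIntegral E x := fun x hx => by
    have h1 : IsIntegral k (⟨x, hSl hx⟩ : Subfield.extendScalars hkl) :=
      Algebra.IsIntegral.isIntegral _
    have h2 : IsIntegral k x := h1.map (Subfield.extendScalars hkl).val
    let _ : Algebra k E := (Subfield.inclusion hkE).toAlgebra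
    have : IsScalarTower k E Ω := IsScalarTower.of_algebraMap_eq fun _ => rfl
    exact h2.tower_top
  have hadj : IntermediateField.adjoin E (l : Set Ω) = IntermediateField.adjoin E (S : Set Ω) := by
    refine le_antisymm (IntermediateField.adjoin_le_iff.2 ?_)
      (IntermediateField.adjoin.mono _ _ _ hSl)
    let T := (IntermediateField.adjoin E (S : Set Ω)).toSubfield
    have hkT : k ≤ T := fun x hx =>
      (IntermediateField.adjoin E (S : Set Ω)).algebraMap_mem ⟨x, hkE hx⟩
    have : Subfield.extendScalars hkl ≤ Subfield.extendScalars hkT := by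
      rw [← hS, IntermediateField.adjoin_le_iff]
      exact IntermediateField.subset_adjoin E (S : Set Ω)
    exact this
  rw [hadj]
  exact IntermediateField.finiteDimensional_adjoin hSi

end Degrees

/-! ### Degrees prime to the residue characteristic -/

section TameDegree

variable {Ω : Type u} [Field Ω] {A : ValuationSubring Ω}

theorem valuation_natCast_le_one (n : ℕ) : A.valuation (n : Ω) ≤ 1 :=
  (A.valuation_le_one_iff _).2 (natCast_mem A n)

theorem dvd_residueExpChar_iff (k : Subfield Ω) {q : ℕ} (hq : q.Prime) :
    q ∣ residueExpChar A k ↔ A.valuation (q : Ω) < 1 := by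
  have h1 : A.valuation (q : Ω) < 1 ↔ (q : IsLocalRing.ResidueField (integers A k)) = 0 := by
    rw [← map_natCast (IsLocalRing.residue (integers A k)), IsLocalRing.residue_eq_zero_iff,
      mem_maximalIdeal_integers_iff, map_natCast (integersHom A k)]
  rw [h1, residueExpChar]
  obtain ⟨p, hp⟩ := ExpChar.exists (IsLocalRing.ResidueField (integers A k))
  rw [ringExpChar.eq _ p]
  cases hp with
  | zero =>
    rw [Nat.dvd_one]
    exact iff_of_false hq.ne_one (Nat.cast_ne_zero.2 hq.ne_zero)
  | prime hp =>
    rw [CharP.cast_eq_zero_iff _ p, Nat.prime_dvd_prime_iff_eq hq hp,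
      Nat.prime_dvd_prime_iff_eq hp hq, eq_comm]

/-- An inseparable minimal polynomial is a polynomial in X^p, so p divides the degree, yet p = 0 in
Ω is not a unit. -/
theorem isSeparable_of_tame_degree {E : Subfield Ω} {F : IntermediateField E Ω}
    [FiniteDimensional E F]
    (h : ∀ q : ℕ, q.Prime → q ∣ Module.finrank E F → A.valuation (q : Ω) = 1) {y : Ω}
    (hy : y ∈ F) : IsSeparable E y := by
  have hyi : IsIntegral E y := by
    have h1 : IsIntegral E (⟨y, hy⟩ : F) := Algebra.IsIntegral.isIntegral _
    exact h1.map F.val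
  obtain ⟨p, hp⟩ := ExpChar.exists E
  cases hp with
  | zero => exact (minpoly.irreducible hyi).separable
  | prime hp =>
    rcases Polynomial.separable_or p (minpoly.irreducible hyi) with hs | ⟨-, g, -, hg⟩
    · exact hs
    · exfalso
      have hdvd : p ∣ Module.finrank E F := by
        refine Dvd.dvd.trans ?_ (IntermediateField.finrank_dvd_of_le_right
          (IntermediateField.adjoin_simple_le_iff.2 hy))
        rw [IntermediateField.adjoin.finrank hyi, ← hg, Polynomial.natDegree_expand]
        exact dvd_mul_left _ _
      have h1 := h p hp hdvd
      have h2 : (p : Ω) = 0 := by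
        rw [← map_natCast (algebraMap E Ω), CharP.cast_eq_zero, map_zero]
      rw [h2, map_zero] at h1
      exact zero_ne_one h1

variable [IsAlgClosed Ω]

/-- A subextension of a finite Galois extension of a strictly henselian field has degree prime to
the residual characteristic if and only if it is fixed by the wild inertia group. -/
theorem IsStrictlyHenselian.tame_degree_iff {E : Subfield Ω} [Algebra.IsAlgebraic E Ω]
    (hE : IsStrictlyHenselian A E) {F M : IntermediateField E Ω} [FiniteDimensional E M]
    [IsGalois E M] (hFM : F ≤ M) :
    (∀ q : ℕ, q.Prime → q ∣ Module.finrank E F → A.valuation (q : Ω) = 1) ↔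
      ∀ σ : Ω ≃ₐ[E] Ω, (∀ x ∈ M, x ≠ 0 → A.valuation (σ x - x) < A.valuation x) →
        ∀ y ∈ F, σ y = y := by
  set w : Valuation M A.ValueGroup := A.valuation.comap (algebraMap M Ω) with hw
  have hlift : ∀ (g : M ≃ₐ[E] M) (x : M), g.liftNormal Ω (x : Ω) = (g x : Ω) := fun g x =>
    AlgEquiv.liftNormal_commutes g Ω x
  have hlt : ∀ (g : M ≃ₐ[E] M) (x y : M), w x < w y → w (g x) < w (g y) := by
    intro g x y hxy
    have hy : w y ≠ 0 := (zero_le.trans_lt hxy).ne'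
    have h1 : w (x / y) < 1 := by
      rw [map_div₀]
      exact (div_lt_one₀ (zero_lt_iff.2 hy)).2 hxy
    have h2 : w (g (x / y)) < 1 := by
      change A.valuation (g (x / y) : Ω) < 1
      rw [← hlift]
      exact (hE.1.valuation_map_lt_one_iff _).2 h1
    have hgy : w (g y) ≠ 0 := by
      rw [Valuation.ne_zero_iff] at hy ⊢
      simpa using hy
    rw [map_div₀, map_div₀] at h2
    exact (div_lt_one₀ (zero_lt_iff.2 hgy)).1 h2
  -- So far g is only known to preserve the order of values. Were w(gx) < w(x), iterating up to the
  -- order of g would give w(x) < w(x).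
  have hnlt : ∀ (g : M ≃ₐ[E] M) (x : M), ¬ w (g x) < w x := by
    intro g x hx
    have hn : ∀ n : ℕ, w ((g ^ (n + 1)) x) < w x := fun n => by
      induction n with
      | zero => simpa using hx
      | succ n ih =>
        rw [pow_succ', AlgEquiv.mul_apply]
        exact (hlt g _ _ ih).trans hx
    obtain ⟨n, hn1⟩ := Nat.exists_eq_succ_of_ne_zero (orderOf_pos g).ne'
    have := hn n
    rw [← Nat.succ_eq_add_one, ← hn1, pow_orderOf_eq_one] at this
    exact lt_irrefl _ this
  have h1 : ∀ (g : M ≃ₐ[E] M) (x : M), w (g x) = w x := fun g x => by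
    refine le_antisymm (not_lt.1 fun h => hnlt g⁻¹ (g x) ?_) (not_lt.1 (hnlt g x))
    rwa [show g⁻¹ (g x) = x from g.symm_apply_apply x]
  have h2 : ∀ (g : M ≃ₐ[E] M) (x : M), w x ≤ 1 → w (g x - x) < 1 := fun g x hx => by
    change A.valuation ((g x : Ω) - x) < 1
    rw [← hlift]
    exact hE.valuation_map_sub_lt _ ((A.valuation_le_one_iff _).1 hx)
  have hiff := WildInertia.wildInertia_le_iff w h1 h2 (IntermediateField.restrict hFM).fixingSubgroup
  rw [← IntermediateField.finrank_eq_fixingSubgroup_index,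
    ← (IntermediateField.restrictAlgEquiv hFM).toLinearEquiv.finrank_eq] at hiff
  have hcast : ∀ q : ℕ, w (q : M) = A.valuation (q : Ω) := fun q => by
    rw [hw, Valuation.comap_apply, map_natCast]
  simp only [hcast] at hiff
  rw [← hiff]
  constructor
  · intro h σ hσ y hy
    have hg : ∀ x : M, ((σ.restrictNormal M x : M) : Ω) = σ x := fun x =>
      AlgEquiv.restrictNormal_commutes σ M x
    have hmem : σ.restrictNormal M ∈ WildInertia.wildInertia w := fun x hx => by
      change A.valuation (((σ.restrictNormal M x : M) : Ω) - x) < A.valuation (x : Ω)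
      rw [hg]
      exact hσ x x.2 (by simpa using hx)
    have := (IntermediateField.mem_fixingSubgroup_iff _ _).1 (h hmem) ⟨y, hFM hy⟩
      ((IntermediateField.mem_restrict hFM _).2 hy)
    rw [← hg ⟨y, hFM hy⟩]
    exact congrArg Subtype.val this
  · intro h g hg
    rw [IntermediateField.mem_fixingSubgroup_iff]
    intro y hy
    apply Subtype.ext
    change (g y : Ω) = y
    rw [← hlift]
    refine h _ (fun x hx hx0 => ?_) y ((IntermediateField.mem_restrict hFM _).1 hy)
    rw [hlift g ⟨x, hx⟩]
    exact hg ⟨x, hx⟩ fun h0 => hx0 (congrArg Subtype.val h0)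

end TameDegree

end ValuedSubfield

/-! ### Unramified and tame extensions in terms of the strict henselization -/

namespace ValuedSubfield

section Characterizations

variable {Ω : Type u} [Field Ω] {A : ValuationSubring Ω}

variable (A) in
theorem henselization_mono {k l : Subfield Ω} (h : k ≤ l) :
    henselization A k ≤ henselization A l :=
  sInf_le_sInf fun _ hE => ⟨h.trans hE.1, hE.2⟩

variable [IsAlgClosed Ω]

variable (A) in
theorem maxUnramified_henselization (k : Subfield Ω) :
    maxUnramified A (henselization A k) = maxUnramified A k :=
  maxUnramified_eq_of_le A (le_henselization A k) (henselization_le_maxUnramified A k)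

/-- k^u is henselian, so it contains l^h as soon as it contains l. -/
theorem isUnramified_iff {k l : Subfield Ω} (h : k ≤ l) :
    IsUnramified A k l ↔ l ≤ maxUnramified A k := by
  rw [IsUnramified, IsUnramifiedHens, maxUnramified_henselization]
  exact ⟨fun H => (le_henselization A l).trans H.2, fun H => ⟨henselization_mono A h,
    sInf_le ⟨H, (isStrictlyHenselian_maxUnramified A k).1⟩⟩⟩

theorem isSeparable_of_mem_maxUnramified {k : Subfield Ω} [Algebra.IsAlgebraic k Ω] {x : Ω}
    (hx : x ∈ maxUnramified A k) : IsSeparable k x :=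
  (maxUnramified_isSeparable_and_fixed (A := A) (AlgEquiv.refl : Ω ≃ₐ[k] Ω)
    (fun a _ _ => by simp) hx).1

/-- σ preserves A, so it carries étale elements to étale elements; the preimage of k^u is therefore
strictly henselian and contains k^u. -/
theorem IsHenselian.map_mem_maxUnramified {k : Subfield Ω} [Algebra.IsAlgebraic k Ω]
    (hk : IsHenselian A k) (σ : Ω ≃ₐ[k] Ω) {x : Ω} (hx : x ∈ maxUnramified A k) :
    σ x ∈ maxUnramified A k := by
  let E := (maxUnramified A k).comap σ.toRingHom
  suffices maxUnramified A k ≤ E from this hx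
  refine sInf_le ⟨fun y hy => ?_, (isStrictlyHenselian_iff A E).2 fun a ha => ?_⟩
  · have : σ y = y := σ.commutes ⟨y, hy⟩
    change σ y ∈ maxUnramified A k
    rw [this]
    exact le_maxUnramified A k hy
  · change σ a ∈ maxUnramified A k
    obtain ⟨f, hm, hE, hA, h0, h1⟩ := ha
    refine (isStrictlyHenselian_iff A _).1 (isStrictlyHenselian_maxUnramified A k) _
      ⟨f.map σ.toRingHom, hm.map _, fun i => ?_, fun i => ?_, ?_, ?_⟩
    · rw [Polynomial.coeff_map]
      exact hE i
    · rw [Polynomial.coeff_map]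
      exact hk.map_mem σ (hA i)
    · have := Polynomial.eval_map_apply (f := σ.toRingHom) (p := f) (x := a)
      rw [h0, map_zero] at this
      exact this
    · have := Polynomial.eval_map_apply (f := σ.toRingHom) (p := f.derivative) (x := a)
      rw [Polynomial.derivative_map]
      change A.valuation (Polynomial.eval (σ.toRingHom a) _) = 1
      rw [this]
      have h2 : A.valuation (σ (f.derivative.eval a)) ≤ 1 :=
        (A.valuation_le_one_iff _).2 (hk.map_mem σ ((A.valuation_le_one_iff _).1 h1.le))
      exact h2.antisymm (not_lt.1 fun hlt =>
        ((hk.valuation_map_lt_one_iff σ).1 hlt).ne h1)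

theorem isGalois_extendScalars_maxUnramified {k m : Subfield Ω} [Algebra.IsAlgebraic k Ω]
    (hkm : henselization A k ≤ m) (h : m ≤ maxUnramified A k) :
    IsGalois m (Subfield.extendScalars h) := by
  have hk : k ≤ m := (le_henselization A k).trans hkm
  have : Algebra.IsAlgebraic m Ω := isAlgebraic_of_le hk
  have : Algebra.IsAlgebraic (henselization A k) Ω := isAlgebraic_of_le (le_henselization A k)
  let _ : Algebra k m := (Subfield.inclusion hk).toAlgebra
  have : IsScalarTower k m Ω := IsScalarTower.of_algebraMap_eq fun _ => rfl
  have hsep : Algebra.IsSeparable m (Subfield.extendScalars h) := by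
    refine (le_separableClosure_iff m Ω _).1 fun x hx => mem_separableClosure_iff.2 ?_
    exact IsSeparable.tower_top m (isSeparable_of_mem_maxUnramified (k := k) hx)
  have hnorm : Normal m (Subfield.extendScalars h) := by
    rw [IntermediateField.normal_iff_forall_map_le']
    rintro σ _ ⟨x, hx, rfl⟩
    have hx' : x ∈ maxUnramified A (henselization A k) := by
      rw [maxUnramified_henselization]
      exact hx
    have := (isHenselian_henselization A k).map_mem_maxUnramified (restrictAlgEquiv hkm σ) hx'
    rw [maxUnramified_henselization] at this
    exact this
  exact ⟨⟩

/-- Base change from m to k^u preserves the degrees of subextensions of l^h/m, by linear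
disjointness. This replaces the choice of m and all finite subextensions by a single degree over
k^u. -/
theorem isTame_iff {k l : Subfield Ω} [Algebra.IsAlgebraic k Ω] (hkl : k ≤ l)
    [FiniteDimensional k (Subfield.extendScalars hkl)] :
    IsTame A k l ↔ ∀ q : ℕ, q.Prime →
      q ∣ Module.finrank (maxUnramified A k)
        (IntermediateField.adjoin (maxUnramified A k) (l : Set Ω)) →
      A.valuation (q : Ω) = 1 := by
  have hnot : ∀ q : ℕ, q.Prime → (¬ q ∣ residueExpChar A (henselization A k) ↔
      A.valuation (q : Ω) = 1) := fun q hq => by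
    rw [dvd_residueExpChar_iff _ hq, lt_iff_le_and_ne, and_iff_right (valuation_natCast_le_one q),
      not_not]
  have hE := isStrictlyHenselian_maxUnramified A k
  constructor
  · rintro ⟨m, h, ⟨hkm, hmE⟩, hLD, hP⟩ q hq hdvd
    rw [maxUnramified_henselization] at hmE
    have hk : k ≤ m := (le_henselization A k).trans hkm
    have hmax : maxUnramified A m = maxUnramified A k := maxUnramified_eq_of_le A hk hmE
    have hLD' : (Subfield.extendScalars h).LinearDisjoint (Subfield.extendScalars hmE) := by
      rw [IsTotallyRamifiedHens] at hLD
      convert hLD using 2 <;> simp only [hmax]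
    -- The definition controls only finite subextensions of l^h/m, so m(l) stands in for l^h.
    let F := IntermediateField.adjoin m (l : Set Ω)
    have hF : F ≤ Subfield.extendScalars h :=
      IntermediateField.adjoin_le_iff.2 (le_henselization A l)
    have hfin : FiniteDimensional m F := finiteDimensional_adjoin_subfield hkl hk
    have hfr := finrank_adjoin_of_linearDisjoint hmE (hLD'.of_le_left hF)
    have hadj : IntermediateField.adjoin (maxUnramified A k) (F : Set Ω) =
        IntermediateField.adjoin (maxUnramified A k) (l : Set Ω) := by
      refine le_antisymm (IntermediateField.adjoin_le_iff.2 ?_)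
        (IntermediateField.adjoin.mono _ _ _ (IntermediateField.subset_adjoin m _))
      let T := (IntermediateField.adjoin (maxUnramified A k) (l : Set Ω)).toSubfield
      have hmT : m ≤ T := fun x hx =>
        (IntermediateField.adjoin (maxUnramified A k) (l : Set Ω)).algebraMap_mem ⟨x, hmE hx⟩
      have : F ≤ Subfield.extendScalars hmT :=
        IntermediateField.adjoin_le_iff.2 (IntermediateField.subset_adjoin _ _)
      exact this
    rw [hadj] at hfr
    rw [hfr, (IntermediateField.restrictAlgEquiv hF).toLinearEquiv.finrank_eq] at hdvd
    have : FiniteDimensional m (IntermediateField.restrict hF) :=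
      (IntermediateField.restrictAlgEquiv hF).toLinearEquiv.finiteDimensional
    exact (hnot q hq).1 (hP.2 _ this q hq hdvd).2
  · intro H
    -- With this m the extension k^u/m is Galois and meets l^h in m, so linear disjointness is
    -- automatic.
    let m := henselization A l ⊓ maxUnramified A k
    have hkm : henselization A k ≤ m :=
      le_inf (henselization_mono A hkl) (henselization_le_maxUnramified A k)
    have hk : k ≤ m := (le_henselization A k).trans hkm
    have hmE : m ≤ maxUnramified A k := inf_le_right
    have hml : m ≤ henselization A l := inf_le_left
    have hmax : maxUnramified A m = maxUnramified A k := maxUnramified_eq_of_le A hk hmE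
    have : Algebra.IsAlgebraic m Ω := isAlgebraic_of_le hk
    have hEalg : Algebra.IsAlgebraic (maxUnramified A k) Ω := isAlgebraic_of_le (hk.trans hmE)
    have := isGalois_extendScalars_maxUnramified hkm hmE
    have hLD : (Subfield.extendScalars hml).LinearDisjoint (Subfield.extendScalars hmE) := by
      refine .of_inf_eq_bot_of_isAlgebraic (le_bot_iff.1 fun x hx => ?_)
      exact IntermediateField.mem_bot.2 ⟨⟨x, hx⟩, rfl⟩
    refine ⟨m, hml, ⟨hkm, by rwa [maxUnramified_henselization]⟩, ?_, inferInstance, ?_⟩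
    · rw [IsTotallyRamifiedHens]
      convert hLD using 2 <;> simp only [hmax]
    · intro E' hE' q hq hdvd
      refine ⟨hq, (hnot q hq).2 (H q hq (hdvd.trans ?_))⟩
      have hle : IntermediateField.lift E' ≤ Subfield.extendScalars hml :=
        IntermediateField.lift_le E'
      rw [(IntermediateField.liftAlgEquiv E').toLinearEquiv.finrank_eq,
        ← finrank_adjoin_of_linearDisjoint hmE (hLD.of_le_left hle)]
      refine IntermediateField.finrank_dvd_of_le_right (IntermediateField.adjoin_le_iff.2 ?_)
      -- The field k^u l is algebraic over the henselian k^u, hence henselian, and so contains l^h.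
      let T := IntermediateField.adjoin (maxUnramified A k) (l : Set Ω)
      have hT : IsHenselian A T.toSubfield := hE.1.mono fun x hx => T.algebraMap_mem ⟨x, hx⟩
      have hlT : henselization A l ≤ T.toSubfield :=
        sInf_le ⟨IntermediateField.subset_adjoin _ _, hT⟩
      exact fun x hx => hlT (hle hx)

end Characterizations

end ValuedSubfield

/-! ### Finitely many elements detect tameness -/

section Compactness

variable {F : Type v} {Ω : Type u} [Field F] [Field Ω] [Algebra F Ω]

/-- τ ↦ τx is constant on cosets of the stabilizer of x, which is open in the Krull topology. -/
theorem isOpen_setOf_apply [Algebra.IsAlgebraic F Ω] (x : Ω) (Q : Ω → Prop) : IsOpen {τ : Ω ≃ₐ[F] Ω | Q (τ x)} := by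
  rw [isOpen_iff_mem_nhds]
  intro τ hτ
  refine Filter.mem_of_superset (((stabilizer_isOpen_of_isIntegral (K := F) x).leftCoset τ).mem_nhds
    ⟨1, Subgroup.one_mem _, mul_one τ⟩) ?_
  rintro _ ⟨g, hg, rfl⟩
  have hg' : g x = x := hg
  change Q ((τ * g) x)
  rwa [AlgEquiv.mul_apply, hg']

theorem isClosed_setOf_apply [Algebra.IsAlgebraic F Ω] (x : Ω) (Q : Ω → Prop) :
    IsClosed {τ : Ω ≃ₐ[F] Ω | Q (τ x)} :=
  ⟨isOpen_setOf_apply x fun z => ¬ Q z⟩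

/-- If the automorphisms subject to a family of conditions, each on the image of one separable
element, fix a finite set of separable elements, then finitely many of the conditions suffice. -/
theorem exists_finset_forall_algEquiv [Normal F Ω] {X : Set Ω} (hX : ∀ x ∈ X, IsSeparable F x)
    {T : Finset Ω} (hT : ∀ y ∈ T, IsSeparable F y) (P : Ω → Ω → Prop)
    (h : ∀ σ : Ω ≃ₐ[F] Ω, (∀ x ∈ X, P x (σ x)) → ∀ y ∈ T, σ y = y) :
    ∃ Y : Finset Ω, ↑Y ⊆ X ∧
      ∀ σ : Ω ≃ₐ[F] Ω, (∀ x ∈ Y, P x (σ x)) → ∀ y ∈ T, σ y = y := by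
  classical
  -- S is Galois over F, so its automorphism group is compact. The conditions cut out closed sets
  -- having no common point with the closed set D of automorphisms that move T.
  let S := separableClosure F Ω
  let X' : X → S := fun x => ⟨x, mem_separableClosure_iff.2 (hX x x.2)⟩
  let T' : T → S := fun y => ⟨y, mem_separableClosure_iff.2 (hT y y.2)⟩
  let C : X → Set (S ≃ₐ[F] S) := fun x => {τ | P x (τ (X' x))}
  let D : Set (S ≃ₐ[F] S) := ⋃ y : T, {τ | τ (T' y) ≠ T' y}
  have hC : ∀ x, IsClosed (C x) := fun x => isClosed_setOf_apply (X' x) fun z => P x z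
  have hD : IsClosed D := isClosed_iUnion_of_finite fun y =>
    isClosed_setOf_apply (T' y) fun z => z ≠ T' y
  have hlift : ∀ (τ : S ≃ₐ[F] S) (x : S), τ.liftNormal Ω (x : Ω) = (τ x : Ω) := fun τ x =>
    AlgEquiv.liftNormal_commutes τ Ω x
  have hempty : D ∩ ⋂ x, C x = ∅ := by
    rw [Set.eq_empty_iff_forall_notMem]
    rintro τ ⟨hτD, hτC⟩
    obtain ⟨y, hy⟩ := Set.mem_iUnion.1 hτD
    refine hy (Subtype.ext ?_)
    rw [← hlift]
    refine h (τ.liftNormal Ω) (fun x hx => ?_) y y.2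
    have := Set.mem_iInter.1 hτC ⟨x, hx⟩
    rw [show τ.liftNormal Ω x = _ from hlift τ (X' ⟨x, hx⟩)]
    exact this
  obtain ⟨u, hu⟩ := hD.isCompact.elim_finite_subfamily_closed C hC hempty
  refine ⟨u.image Subtype.val, by simp, fun σ hσ y hy => ?_⟩
  by_contra hne
  have hres : ∀ x : S, ((σ.restrictNormal S x : S) : Ω) = σ x := fun x =>
    AlgEquiv.restrictNormal_commutes σ S x
  have : σ.restrictNormal S ∈ D ∩ ⋂ x ∈ u, C x := by
    refine ⟨Set.mem_iUnion.2 ⟨⟨y, hy⟩, fun hfix => hne ?_⟩, Set.mem_iInter₂.2 fun x hx => ?_⟩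
    · have := congrArg Subtype.val hfix
      rw [hres] at this
      exact this
    · change P x ((σ.restrictNormal S (X' x) : S) : Ω)
      rw [hres]
      exact hσ x (Finset.mem_image_of_mem _ hx)
  rw [hu] at this
  exact this

/-- A condition that finitely many of the elements `φ x (σ x)` be non-units is preserved in a
neighbourhood of a valuation ring. -/
theorem exists_finset_valuation_lt_one [Normal F Ω] (A : ValuationSubring Ω) (X : Finset Ω)
    (φ : Ω → Ω → Ω) :
    ∃ Z : Finset Ω, (∀ z ∈ Z, z ∈ A) ∧ ∀ A' : ValuationSubring Ω, (∀ z ∈ Z, z ∈ A') →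
      ∀ x ∈ X, ∀ σ : Ω ≃ₐ[F] Ω, A'.valuation (φ x (σ x)) < 1 → A.valuation (φ x (σ x)) < 1 := by
  classical
  -- If φ x (σx) is not a non-unit for A, its inverse lies in A, hence in Z and in A', so it is not
  -- a non-unit for A' either.
  let Z : Finset Ω := (X.biUnion fun x =>
    ((minpoly F x).aroots Ω).toFinset.image fun z => (φ x z)⁻¹).filter (· ∈ A)
  refine ⟨Z, fun z hz => (Finset.mem_filter.1 hz).2, fun A' hA' x hx σ hσ => ?_⟩
  by_contra hnot
  rw [ValuedSubfield.valuation_lt_one_iff_inv] at hσ hnot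
  push Not at hnot
  refine (hσ.resolve_left hnot.1) (hA' _ (Finset.mem_filter.2 ⟨?_, hnot.2⟩))
  refine Finset.mem_biUnion.2 ⟨x, hx, Finset.mem_image.2 ⟨σ x, ?_, rfl⟩⟩
  rw [Multiset.mem_toFinset]
  exact (isConjRoot_iff_mem_minpoly_aroots (Algebra.IsIntegral.isIntegral x)).1
    (isConjRoot_iff_exists_algEquiv.2 ⟨σ, rfl⟩).symm

end Compactness

/-! ### Persistence of the conditions near a valuation ring of the algebraic closure -/

namespace ValuedSubfield

section Neighbourhoods

variable {Ω : Type u} [Field Ω] {A : ValuationSubring Ω}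

/-- View an automorphism over a field that fixes a larger field as an automorphism over the
latter. -/
def extendAlgEquiv {E F : Subfield Ω} (σ : Ω ≃ₐ[E] Ω) (h : ∀ x ∈ F, σ x = x) : Ω ≃ₐ[F] Ω :=
  AlgEquiv.ofRingEquiv (f := σ.toRingEquiv) fun x => h x x.2

theorem isSeparable_of_le {k E : Subfield Ω} (h : k ≤ E) {x : Ω} (hx : IsSeparable k x) :
    IsSeparable E x := by
  let _ : Algebra k E := (Subfield.inclusion h).toAlgebra
  have : IsScalarTower k E Ω := IsScalarTower.of_algebraMap_eq fun _ => rfl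
  exact IsSeparable.tower_top E hx

theorem isSeparable_trans {k E : Subfield Ω} (h : ∀ x ∈ E, IsSeparable k x) {x : Ω}
    (hx : IsSeparable E x) : IsSeparable k x := by
  let i : E →+* separableClosure k Ω :=
    E.subtype.codRestrict (separableClosure k Ω) fun y => mem_separableClosure_iff.2 (h y y.2)
  let _ : Algebra E (separableClosure k Ω) := i.toAlgebra
  have : IsScalarTower E (separableClosure k Ω) Ω := IsScalarTower.of_algebraMap_eq fun _ => rfl
  have h2 : x ∈ separableClosure (separableClosure k Ω) Ω :=
    mem_separableClosure_iff.2 (IsSeparable.tower_top (separableClosure k Ω) hx)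
  rw [separableClosure.separableClosure_eq_bot, IntermediateField.mem_bot] at h2
  obtain ⟨s, rfl⟩ := h2
  exact mem_separableClosure_iff.1 s.2

theorem exists_finset_generating {k l : Subfield Ω} (hkl : k ≤ l)
    [FiniteDimensional k (Subfield.extendScalars hkl)] :
    ∃ T : Finset Ω, ↑T ⊆ (l : Set Ω) ∧
      ∀ σ : Ω ≃ₐ[k] Ω, (∀ y ∈ T, σ y = y) → ∀ y ∈ l, σ y = y := by
  have hfg : Algebra.EssFiniteType k (Subfield.extendScalars hkl) := inferInstance
  obtain ⟨S, hS⟩ := IntermediateField.essFiniteType_iff.1 hfg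
  refine ⟨S, ?_, fun σ hσ y hy => ?_⟩
  · have : (S : Set Ω) ⊆ Subfield.extendScalars hkl := by
      rw [← hS]; exact IntermediateField.subset_adjoin _ _
    exact this
  · have hle : Subfield.extendScalars hkl ≤
        IntermediateField.fixedField (Subgroup.zpowers σ) := by
      rw [← hS, IntermediateField.adjoin_le_iff]
      rintro z hz ⟨τ, n, rfl⟩
      exact (MulAction.mem_stabilizer_iff.1
        ((MulAction.stabilizer (Ω ≃ₐ[k] Ω) z).zpow_mem (hσ z hz) n))
    exact hle hy ⟨σ, Subgroup.mem_zpowers σ⟩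

variable [IsAlgClosed Ω]

/-- Near A, automorphisms over the k^u of A' satisfy the finitely many inertia conditions of A, so
they fix l; as l/k is separable, l lies in that k^u. The set X joins Z because inertia of A'
controls σx − x only for x in A'. -/
theorem IsUnramified.exists_nhds {k l : Subfield Ω} [Algebra.IsAlgebraic k Ω] (hkl : k ≤ l)
    [FiniteDimensional k (Subfield.extendScalars hkl)] (h : IsUnramified A k l) :
    ∃ Z : Finset Ω, (∀ z ∈ Z, z ∈ A) ∧
      ∀ A' : ValuationSubring Ω, (∀ z ∈ Z, z ∈ A') → IsUnramified A' k l := by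
  classical
  rw [isUnramified_iff hkl] at h
  have hsep : ∀ y ∈ l, IsSeparable k y := fun y hy => isSeparable_of_mem_maxUnramified (h hy)
  obtain ⟨T, hTl, hT⟩ := exists_finset_generating hkl
  obtain ⟨X, hXA, hX⟩ := exists_finset_forall_algEquiv (F := k)
    (X := {x | x ∈ A ∧ IsSeparable k x}) (fun x hx => hx.2) (T := T)
    (fun y hy => hsep y (hTl hy)) (fun x z => A.valuation (z - x) < 1) fun σ hσ y hy =>
      (maxUnramified_isSeparable_and_fixed σ (fun a ha hs => hσ a ⟨ha, hs⟩) (h (hTl hy))).2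
  obtain ⟨Z, hZA, hZ⟩ := exists_finset_valuation_lt_one (F := k) A X fun x z => z - x
  refine ⟨X ∪ Z, fun z hz => (Finset.mem_union.1 hz).elim (fun hz => (hXA hz).1) (hZA z),
    fun A' hA' => ?_⟩
  rw [isUnramified_iff hkl]
  intro y hy
  have hkE := le_maxUnramified A' k
  have : Algebra.IsAlgebraic (maxUnramified A' k) Ω := isAlgebraic_of_le hkE
  obtain ⟨c, rfl⟩ := mem_of_forall_algEquiv_eq (F := maxUnramified A' k)
    (isSeparable_of_le hkE (hsep y hy)) fun σ => by
      refine hT (restrictAlgEquiv hkE σ) (hX (restrictAlgEquiv hkE σ) fun x hx => ?_) y hy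
      refine hZ A' (fun z hz => hA' z (Finset.mem_union_right _ hz)) x hx _ ?_
      exact (isStrictlyHenselian_maxUnramified A' k).valuation_map_sub_lt σ
        (hA' x (Finset.mem_union_left _ hx))
  exact c.2

theorem IsTame.exists_nhds {k l : Subfield Ω} [Algebra.IsAlgebraic k Ω] (hkl : k ≤ l)
    [FiniteDimensional k (Subfield.extendScalars hkl)] (h : IsTame A k l) :
    ∃ Z : Finset Ω, (∀ z ∈ Z, z ∈ A) ∧
      ∀ A' : ValuationSubring Ω, (∀ z ∈ Z, z ∈ A') → IsTame A' k l := by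
  classical
  rw [isTame_iff hkl] at h
  have hdiv : ∀ (B : ValuationSubring Ω) {x z : Ω}, x ≠ 0 →
      (B.valuation ((z - x) / x) < 1 ↔ B.valuation (z - x) < B.valuation x) := fun B x z hx => by
    rw [map_div₀, div_lt_one₀ (zero_lt_iff.2 ((Valuation.ne_zero_iff _).2 hx))]
  obtain ⟨T, hTl, hT⟩ := exists_finset_generating hkl
  have hsep : ∀ y ∈ l, IsSeparable k y := fun y hy => by
    have := finiteDimensional_adjoin_subfield hkl (le_maxUnramified A k)
    exact isSeparable_trans (fun x hx => isSeparable_of_mem_maxUnramified hx)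
      (isSeparable_of_tame_degree h (IntermediateField.subset_adjoin _ _ hy))
  obtain ⟨X, hXA, hX⟩ := exists_finset_forall_algEquiv (F := k)
    (X := {x | x ≠ 0 ∧ IsSeparable k x}) (fun x hx => hx.2) (T := T)
    (fun y hy => hsep y (hTl hy)) (fun x z => A.valuation ((z - x) / x) < 1) (by
      intro σ hσ y hy
      have hkE := le_maxUnramified A k
      have : Algebra.IsAlgebraic (maxUnramified A k) Ω := isAlgebraic_of_le hkE
      -- The wild condition implies the inertia condition on A, so σ fixes k^u and can be viewed
      -- over it.
      have hσE : ∀ x ∈ maxUnramified A k, σ x = x := fun x hx =>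
        (maxUnramified_isSeparable_and_fixed σ (fun a ha hs => by
          by_cases ha0 : a = 0
          · simp [ha0]
          · exact ((hdiv A ha0).1 (hσ a ⟨ha0, hs⟩)).trans_le
              ((A.valuation_le_one_iff a).2 ha)) hx).2
      have := finiteDimensional_adjoin_subfield hkl hkE
      let F := IntermediateField.adjoin (maxUnramified A k) (l : Set Ω)
      let M := IntermediateField.normalClosure (maxUnramified A k) F Ω
      have : Algebra.IsSeparable (maxUnramified A k) F :=
        (le_separableClosure_iff _ Ω F).1 fun x hx =>
          mem_separableClosure_iff.2 (isSeparable_of_tame_degree h hx)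
      have hMsep : M ≤ separableClosure (maxUnramified A k) Ω :=
        IntermediateField.normalClosure_le_iff_of_normal.2 (le_separableClosure _ _ F)
      have : Algebra.IsSeparable (maxUnramified A k) M := (le_separableClosure_iff _ Ω M).1 hMsep
      have : IsGalois (maxUnramified A k) M := ⟨⟩
      refine ((isStrictlyHenselian_maxUnramified A k).tame_degree_iff
        (IntermediateField.le_normalClosure F)).1 h (extendAlgEquiv σ hσE) (fun x hx hx0 => ?_) y
        (IntermediateField.subset_adjoin _ _ (hTl hy))
      exact (hdiv A hx0).1 (hσ x ⟨hx0, isSeparable_trans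
        (fun x hx => isSeparable_of_mem_maxUnramified hx)
        (mem_separableClosure_iff.1 (hMsep hx))⟩))
  obtain ⟨Z, hZA, hZ⟩ := exists_finset_valuation_lt_one (F := k) A X fun x z => (z - x) / x
  refine ⟨Z, hZA, fun A' hA' => ?_⟩
  rw [isTame_iff hkl]
  have hkE := le_maxUnramified A' k
  have : Algebra.IsAlgebraic (maxUnramified A' k) Ω := isAlgebraic_of_le hkE
  have := finiteDimensional_adjoin_subfield hkl hkE
  let F := IntermediateField.adjoin (maxUnramified A' k) (l : Set Ω)
  let F₁ := IntermediateField.adjoin (maxUnramified A' k) (X : Set Ω)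
  have : FiniteDimensional (maxUnramified A' k) F₁ :=
    IntermediateField.finiteDimensional_adjoin fun x _ => Algebra.IsIntegral.isIntegral x
  -- M has to contain X besides l, since wild inertia is tested on elements of M only.
  let M := IntermediateField.normalClosure (maxUnramified A' k) (F ⊔ F₁ : IntermediateField _ _) Ω
  have hMsep : M ≤ separableClosure (maxUnramified A' k) Ω :=
    IntermediateField.normalClosure_le_iff_of_normal.2 (sup_le
      (IntermediateField.adjoin_le_iff.2 fun x hx =>
        mem_separableClosure_iff.2 (isSeparable_of_le hkE (hsep x hx)))
      (IntermediateField.adjoin_le_iff.2 fun x hx =>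
        mem_separableClosure_iff.2 (isSeparable_of_le hkE (hXA hx).2)))
  have : Algebra.IsSeparable (maxUnramified A' k) M := (le_separableClosure_iff _ Ω M).1 hMsep
  have : IsGalois (maxUnramified A' k) M := ⟨⟩
  have hM : F ⊔ F₁ ≤ M := IntermediateField.le_normalClosure _
  refine ((isStrictlyHenselian_maxUnramified A' k).tame_degree_iff
    (le_sup_left.trans hM)).2 fun σ hσ y hy => ?_
  have hl : ∀ z ∈ l, σ z = z := fun z hz =>
    hT (restrictAlgEquiv hkE σ) (hX (restrictAlgEquiv hkE σ) fun x hx =>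
      hZ A' hA' x hx _ ((hdiv A' (hXA hx).1).2 (hσ x
        (hM (le_sup_right (a := F) (IntermediateField.subset_adjoin _ _ hx))) (hXA hx).1))) z hz
  have hfix : F ≤ IntermediateField.fixedField (Subgroup.zpowers σ) := by
    rw [IntermediateField.adjoin_le_iff]
    rintro z hz ⟨τ, n, rfl⟩
    exact (MulAction.mem_stabilizer_iff.1
      ((MulAction.stabilizer (Ω ≃ₐ[maxUnramified A' k] Ω) z).zpow_mem (hl z hz) n))
  exact hfix hy ⟨σ, Subgroup.mem_zpowers σ⟩

end Neighbourhoods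

end ValuedSubfield

/-! ### The projection of Riemann–Zariski spaces -/

namespace ValuationSubring

theorem isOpen_of_forall_exists_finset {L : Type u} [Field L] {U : Set (ValuationSubring L)}
    (h : ∀ O ∈ U, ∃ Y : Finset L, (∀ y ∈ Y, y ∈ O) ∧
      ∀ O' : ValuationSubring L, (∀ y ∈ Y, y ∈ O') → O' ∈ U) : IsOpen U := by
  rw [isOpen_iff_mem_nhds]
  intro O hO
  obtain ⟨Y, hY, hYU⟩ := h O hO
  have hopen : IsOpen (⋂ y ∈ Y, {O' : ValuationSubring L | y ∈ O'}) :=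
    isOpen_biInter_finset fun y _ => TopologicalSpace.isOpen_generateFrom_of_mem ⟨y, rfl⟩
  exact Filter.mem_of_superset (hopen.mem_nhds (Set.mem_iInter₂.2 hY))
    fun O' hO' => hYU O' (Set.mem_iInter₂.1 hO')

section Projection

variable {L : Type v} {Ω : Type u} [Field L] [Field Ω] [Algebra L Ω]

variable (Ω) in
-- Some valuation ring A of Ω dominates O. If x ∈ A with x ∉ O, then x⁻¹ would be a unit of A, hence
-- of O, a contradiction.
theorem exists_comap_eq (O : ValuationSubring L) :
    ∃ A : ValuationSubring Ω, A.comap (algebraMap L Ω) = O := by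
  obtain ⟨A, hA, hloc⟩ := IsLocalRing.exists_factor_valuationRing
    ((algebraMap L Ω).comp O.subtype)
  refine ⟨A, le_antisymm (fun x hx => ?_) fun x hx => hA ⟨x, hx⟩⟩
  by_contra hxO
  have hx0 : x ≠ 0 := fun h => hxO (h ▸ O.zero_mem)
  have hinv : x⁻¹ ∈ O := (O.mem_or_inv_mem x).resolve_left hxO
  have hu : IsUnit (⟨x⁻¹, hinv⟩ : O) := by
    refine hloc.map_nonunit _ (IsUnit.of_mul_eq_one ⟨algebraMap L Ω x, hx⟩ (Subtype.ext ?_))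
    change algebraMap L Ω x⁻¹ * algebraMap L Ω x = 1
    rw [← map_mul, inv_mul_cancel₀ hx0, map_one]
  obtain ⟨y, hy⟩ := hu.exists_right_inv
  have hy' : x⁻¹ * (y : L) = 1 := congrArg Subtype.val hy
  have : (y : L) = x := by rw [← mul_inv_cancel_left₀ hx0 (y : L), hy', mul_one]
  exact hxO (this ▸ y.2)

theorem coeff_prod_X_sub_C_lt_one (A : ValuationSubring Ω) (s : Multiset Ω)
    (hs : ∀ r ∈ s, A.valuation r < 1) (i : ℕ) :
    A.valuation ((s.map fun r => X - C r).prod.coeff i) ≤ 1 ∧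
      (i < Multiset.card s → A.valuation ((s.map fun r => X - C r).prod.coeff i) < 1) := by
  induction s using Multiset.induction_on generalizing i with
  | empty => simpa [Polynomial.coeff_one, apply_ite] using by split_ifs <;> simp
  | cons r s ih =>
    have ih := ih fun r hr => hs r (Multiset.mem_cons_of_mem hr)
    have hr := hs r (Multiset.mem_cons_self r s)
    have hmul : ∀ j, A.valuation (r * (s.map fun r => X - C r).prod.coeff j) < 1 := fun j => by
      rw [map_mul]
      exact mul_lt_one_of_lt_of_le hr (ih j).1
    rw [Multiset.map_cons, Multiset.prod_cons, sub_mul, Polynomial.coeff_sub,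
      Polynomial.coeff_C_mul, Multiset.card_cons]
    cases i with
    | zero =>
      rw [Polynomial.coeff_X_mul_zero, zero_sub, Valuation.map_neg]
      exact ⟨(hmul 0).le, fun _ => hmul 0⟩
    | succ i =>
      rw [Polynomial.coeff_X_mul]
      exact ⟨Valuation.map_sub_le _ (ih i).1 (hmul _).le, fun hi =>
        Valuation.map_sub_lt _ ((ih i).2 (by omega)) (hmul _)⟩

/-- The restriction of valuation rings to a subfield over which the field is algebraic is an open
map: the rings near `A ∩ L` extend to rings near `A`. -/
theorem exists_finset_extend [IsAlgClosed Ω] [Algebra.IsAlgebraic L Ω] (A : ValuationSubring Ω)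
    (Z : Finset Ω) (hZ : ∀ z ∈ Z, z ∈ A) :
    ∃ Y : Finset L, (∀ y ∈ Y, y ∈ A.comap (algebraMap L Ω)) ∧
      ∀ O : ValuationSubring L, (∀ y ∈ Y, y ∈ O) →
        ∃ A' : ValuationSubring Ω, A'.comap (algebraMap L Ω) = O ∧ ∀ z ∈ Z, z ∈ A' := by
  classical
  have hint : ∀ x : Ω, IsIntegral L x := fun x => Algebra.IsIntegral.isIntegral x
  choose! d _ hd1 hdi hzdi using fun (z : Ω) (hz : z ∈ Z) =>
    A.exists_isIntegral_mul (F := L) (hZ z hz) (Algebra.IsAlgebraic.isAlgebraic _)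
  -- s is a common denominator: a unit of A, with s and all zs integral over A ∩ L.
  set s := ∏ z ∈ Z, d z with hs
  have hs1 : A.valuation s = 1 := by
    rw [hs, map_prod]
    exact Finset.prod_eq_one hd1
  have hsi : IsIntegral (A.comap (algebraMap L Ω)) s := IsIntegral.prod _ hdi
  have hzsi : ∀ z ∈ Z, IsIntegral (A.comap (algebraMap L Ω)) (z * s) := fun z hz => by
    rw [hs, ← Finset.mul_prod_erase _ _ hz, ← mul_assoc]
    exact (hzdi z hz).mul (IsIntegral.prod _ fun w hw => hdi w (Finset.mem_of_mem_erase hw))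
  -- If all lower coefficients were non-units, the minimal equation would make s a non-unit.
  obtain ⟨j, hj, hcj⟩ : ∃ j < (minpoly L s).natDegree,
      A.valuation (algebraMap L Ω ((minpoly L s).coeff j)) = 1 := by
    by_contra! hcon
    have h1 : A.valuation (s ^ (minpoly L s).natDegree) = 1 := by rw [map_pow, hs1, one_pow]
    have h2 := minpoly.aeval L s
    rw [Polynomial.aeval_eq_sum_range, Finset.sum_range_succ, Polynomial.coeff_natDegree,
      (minpoly.monic (hint s)).leadingCoeff, one_smul] at h2
    rw [eq_neg_of_add_eq_zero_right h2, Valuation.map_neg] at h1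
    refine (Valuation.map_sum_lt A.valuation one_ne_zero fun i hi => ?_).ne h1
    rw [Algebra.smul_def, map_mul, map_pow, hs1, one_pow, mul_one]
    exact lt_of_le_of_ne ((A.valuation_le_one_iff _).2 (minpoly_coeff_mem_of_isIntegral hsi i))
      (hcon i (Finset.mem_range.1 hi))
  -- Containing Y makes s and the zs integral over O and the j-th coefficient a unit of O.
  let Y : Finset L := insert ((minpoly L s).coeff j)⁻¹ ((minpoly L s).coeffs ∪
    Z.biUnion fun z => (minpoly L (z * s)).coeffs)
  have hcoeffs : ∀ (R : ValuationSubring L) (x : Ω), (∀ c ∈ (minpoly L x).coeffs, c ∈ R) ↔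
      IsIntegral R x := fun R x => by
    refine ⟨fun h => isIntegral_of_minpoly_coeff_mem (hint x) fun i => ?_, fun h c hc => ?_⟩
    · by_cases h0 : (minpoly L x).coeff i = 0
      · rw [h0]; exact R.zero_mem
      · exact h _ (Polynomial.coeff_mem_coeffs h0)
    · obtain ⟨i, -, rfl⟩ := Polynomial.mem_coeffs_iff.1 hc
      exact minpoly_coeff_mem_of_isIntegral h i
  refine ⟨Y, fun y hy => ?_, fun O hO => ?_⟩
  · rw [Finset.mem_insert, Finset.mem_union, Finset.mem_biUnion] at hy
    rcases hy with rfl | hy | ⟨z, hz, hy⟩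
    · rw [ValuationSubring.mem_comap, ← A.valuation_le_one_iff, map_inv₀, map_inv₀, hcj, inv_one]
    · exact (hcoeffs _ s).2 hsi y hy
    · exact (hcoeffs _ (z * s)).2 (hzsi z hz) y hy
  · have hsO : IsIntegral O s := (hcoeffs O s).1 fun c hc => hO c
      (Finset.mem_insert_of_mem (Finset.mem_union_left _ hc))
    have hzsO : ∀ z ∈ Z, IsIntegral O (z * s) := fun z hz => (hcoeffs O _).1 fun c hc => hO c
      (Finset.mem_insert_of_mem (Finset.mem_union_right _ (Finset.mem_biUnion.2 ⟨z, hz, hc⟩)))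
    obtain ⟨B, hB⟩ := exists_comap_eq Ω O
    -- If all conjugates of s were non-units of B, so would be every coefficient below the leading
    -- one, including the j-th.
    obtain ⟨r, hr, hr1⟩ : ∃ r ∈ (minpoly L s).aroots Ω, r⁻¹ ∈ B := by
      by_contra! hcon
      have hlt := (coeff_prod_X_sub_C_lt_one B ((minpoly L s).aroots Ω) (fun r hr =>
        ValuedSubfield.valuation_lt_one_iff_inv.2 (.inr (hcon r hr))) j).2 (by
          rw [Polynomial.aroots, ← (IsAlgClosed.splits _).natDegree_eq_card_roots,
            Polynomial.natDegree_map]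
          exact hj)
      rw [Polynomial.aroots, ← (IsAlgClosed.splits _).eq_prod_roots_of_monic
        ((minpoly.monic (hint s)).map _), Polynomial.coeff_map,
        ValuedSubfield.valuation_lt_one_iff_inv, ← map_inv₀] at hlt
      refine hlt.elim (fun h0 => ?_) fun hnot => hnot ?_
      · rw [h0, map_zero] at hcj
        exact zero_ne_one hcj
      · have := hO _ (Finset.mem_insert_self _ _)
        rw [← hB] at this
        exact this
    -- Pulling B back along a σ with σs = r leaves its trace O on L unchanged and puts s⁻¹ into the
    -- ring; then z = (zs)s⁻¹ lies there too.
    obtain ⟨σ, rfl⟩ := isConjRoot_iff_exists_algEquiv.1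
      ((isConjRoot_iff_mem_minpoly_aroots (hint s)).2 hr).symm
    have hA' : (B.comap σ.toRingHom).comap (algebraMap L Ω) = O := by
      rw [← hB]
      ext x
      change σ (algebraMap L Ω x) ∈ B ↔ algebraMap L Ω x ∈ B
      rw [σ.commutes]
    refine ⟨B.comap σ.toRingHom, hA', fun z hz => ?_⟩
    have hOB : ∀ c ∈ O, algebraMap L Ω c ∈ B.comap σ.toRingHom := fun c hc => by
      rw [← hA'] at hc
      exact hc
    have h1 : s⁻¹ ∈ B.comap σ.toRingHom := by
      change σ s⁻¹ ∈ B
      rwa [map_inv₀]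
    have hs0 : s ≠ 0 := fun h0 => by simp [h0] at hs1
    have := (B.comap σ.toRingHom).mul_mem _ _ (mem_of_isIntegral (hzsO z hz) _ hOB) h1
    rwa [mul_inv_cancel_right₀ hs0] at this

end Projection

end ValuationSubring

/-! ### Openness of the loci -/

section Loci

variable {K : Type v} {L : Type u} [Field K] [Field L] [Algebra K L]

variable (K L) in
theorem fieldRange_le_fieldRange_algebraicClosure :
    (algebraMap K (AlgebraicClosure L)).fieldRange ≤
      (algebraMap L (AlgebraicClosure L)).fieldRange := by
  rintro _ ⟨x, rfl⟩
  exact ⟨algebraMap K L x, (IsScalarTower.algebraMap_apply K L _ x).symm⟩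

theorem isAlgebraic_fieldRange {F Ω : Type*} [Field F] [Field Ω] [Algebra F Ω]
    [Algebra.IsAlgebraic F Ω] : Algebra.IsAlgebraic (algebraMap F Ω).fieldRange Ω :=
  let _ : Algebra F (algebraMap F Ω).fieldRange := (algebraMap F Ω).rangeRestrictField.toAlgebra
  have : IsScalarTower F (algebraMap F Ω).fieldRange Ω := IsScalarTower.of_algebraMap_eq fun _ => rfl
  Algebra.IsAlgebraic.tower_top (K := F) _

theorem finiteDimensional_fieldRange [FiniteDimensional K L] :
    FiniteDimensional (algebraMap K (AlgebraicClosure L)).fieldRange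
      (Subfield.extendScalars (fieldRange_le_fieldRange_algebraicClosure K L)) := by
  let e₁ : K ≃+* (algebraMap K (AlgebraicClosure L)).fieldRange :=
    RingEquiv.ofBijective (algebraMap K (AlgebraicClosure L)).rangeRestrictField
      ⟨RingHom.injective _, RingHom.rangeRestrictField_bijective _ |>.2⟩
  let e₂ : L ≃+* (algebraMap L (AlgebraicClosure L)).fieldRange :=
    RingEquiv.ofBijective (algebraMap L (AlgebraicClosure L)).rangeRestrictField
      ⟨RingHom.injective _, RingHom.rangeRestrictField_bijective _ |>.2⟩
  exact Module.Finite.of_equiv_equiv e₁ (B₂ := Subfield.extendScalars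
    (fieldRange_le_fieldRange_algebraicClosure K L)) e₂ (RingHom.ext fun x => Subtype.ext
      (IsScalarTower.algebraMap_apply K L (AlgebraicClosure L) x))

end Loci

theorem mainTheorem9 {K : Type v} {L : Type u} [Field K] [Field L] [Algebra K L]
    [FiniteDimensional K L] :
    IsOpen (tameLocus K L) ∧ IsOpen (unramifiedLocus K L) := by
  have : Algebra.IsAlgebraic K (AlgebraicClosure L) := Algebra.IsAlgebraic.trans K L _
  have : Algebra.IsAlgebraic (algebraMap K (AlgebraicClosure L)).fieldRange (AlgebraicClosure L) :=
    isAlgebraic_fieldRange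
  have := finiteDimensional_fieldRange (K := K) (L := L)
  have hkl := fieldRange_le_fieldRange_algebraicClosure K L
  constructor
  · refine ValuationSubring.isOpen_of_forall_exists_finset ?_
    rintro O ⟨A, rfl, hA⟩
    obtain ⟨Z, hZA, hZ⟩ := hA.exists_nhds hkl
    obtain ⟨Y, hYA, hY⟩ := A.exists_finset_extend (L := L) Z hZA
    refine ⟨Y, hYA, fun O' hO' => ?_⟩
    obtain ⟨A', hA', hZA'⟩ := hY O' hO'
    exact ⟨A', hA', hZ A' hZA'⟩
  · refine ValuationSubring.isOpen_of_forall_exists_finset ?_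
    rintro O ⟨A, rfl, hA⟩
    obtain ⟨Z, hZA, hZ⟩ := hA.exists_nhds hkl
    obtain ⟨Y, hYA, hY⟩ := A.exists_finset_extend (L := L) Z hZA
    refine ⟨Y, hYA, fun O' hO' => ?_⟩
    obtain ⟨A', hA', hZA'⟩ := hY O' hO'
    exact ⟨A', hA', hZ A' hZA'⟩
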